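/- Let $\alpha\in(1,2)$, let $\mu$ be the symmetric $\alpha$-stable probability law on $\mathbb R$ with characteristic function $e^{-|\lambda|^\alpha}$, and for $t>0$ let $p(t,\cdot)$ be the continuous probability density with $\int_{\mathbb R} e^{i\lambda x}p(t,x)\,dx=e^{-t|\lambda|^\alpha}$, that is, $p(t,x)=\frac1{2\pi}\int_{\mathbb R}e^{-t|\lambda|^\alpha}\cos(\lambda x)\,d\lambda$. Put $d_\alpha=\big(\int_{\mathbb R}\frac{1-\cos y}{|y|^{1+\alpha}}\,dy\big)^{-1}$ and $$\Delta^{\alpha/2}f(x)=d_\alpha\lim_{r\downarrow0}\int_{\mathbb R\setminus(-r,r)}\frac{f(x+y)-f(x)}{|y|^{1+\alpha}}\,dy .$$ Let $h:\mathbb R\to\mathbb R$ be Lipschitz, $\mu(h)=\int h\,d\mu$, $\|h'\|=\sup_x|h'(x)|$ (over the points $x$ where $h$ is differentiable), and let $f$ be the solution of Stein's equation $\Delta^{\alpha/2}f(x)-\frac1\alpha xf'(x)=h(x)-\mu(h)$ defined by $$f(x)=-\int_0^\infty\int_{\mathbb R}p\big(1-e^{-t},\,y-e^{-t/\alpha}x\big)\,\big(h(y)-\mu(h)\big)\,dy\,dt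 .$$ Then the integrals defining $\mu(h)$ and $f$ converge absolutely (the outer one as an integral in $t$ of the inner one), $\Delta^{\alpha/2}f(x)$ exists for every $x\in\mathbb R$ (with absolutely convergent truncated integrals), and for every $\gamma\in(0,1)$ $$\sup_{x\ne y}\frac{|\Delta^{\alpha/2}f(x)-\Delta^{\alpha/2}f(y)|}{|x-y|^\gamma}\le\frac{d_\alpha}{\alpha}\left[\frac{16}{\pi(2-\alpha)}\sqrt{\frac{\alpha+3}{\alpha}}+\frac{16}{\pi(\alpha-1)}\sqrt{\frac{2\alpha+1}{\alpha}}\right]\mathrm B\Big(\frac{1-\gamma}{\alpha},\frac{\gamma+\alpha}{\alpha}\Big)\|h'\| ,$$ where $\mathrm B$ is the Beta function. -/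

import Mathlib

open MeasureTheory Filter Topology Set

noncomputable section

namespace StableStein

/-- `d_α = (∫_ℝ (1 - cos y) / |y|^(1+α) dy)⁻¹`. -/
def dConst (α : ℝ) : ℝ :=
  (∫ y : ℝ, (1 - Real.cos y) / |y| ^ (1 + α))⁻¹

/-- `μ` is the symmetric `α`-stable law with characteristic function `exp (-|u|^α)`. -/
def IsStandardStable (α : ℝ) (μ : Measure ℝ) : Prop :=
  IsProbabilityMeasure μ ∧
    ∀ u : ℝ, charFun μ u = ((Real.exp (-|u| ^ α) : ℝ) : ℂ)

/-- For `t > 0`, the (continuous) density `p(t, ·)` of the law with characteristic function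
`exp (-t |u|^α)`: by Fourier inversion it is `(2π)⁻¹ ∫ exp (-i u x) exp (-t |u|^α) du`, and the
sine part vanishes by symmetry. -/
def stableDensity (α t x : ℝ) : ℝ :=
  (2 * Real.pi)⁻¹ * ∫ u : ℝ, Real.cos (u * x) * Real.exp (-t * |u| ^ α)

/-- `∫_{ℝ \ (-r, r)} (f(x+y) - f(x)) / |y|^(1+α) dy`. -/
def truncatedIntegral (α : ℝ) (f : ℝ → ℝ) (x r : ℝ) : ℝ :=
  ∫ y in {y : ℝ | r ≤ |y|}, (f (x + y) - f x) / |y| ^ (1 + α)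

/-- The principal value integral `p.v. ∫ (f(x+y) - f(x)) / |y|^(1+α) dy` exists:
every truncated integral converges absolutely, and they have a finite limit as `r ↓ 0`. -/
def FracLaplacianExists (α : ℝ) (f : ℝ → ℝ) (x : ℝ) : Prop :=
  (∀ r : ℝ, 0 < r →
    IntegrableOn (fun y : ℝ => (f (x + y) - f x) / |y| ^ (1 + α)) {y : ℝ | r ≤ |y|}) ∧
  ∃ L : ℝ, Tendsto (truncatedIntegral α f x) (𝓝[>] 0) (𝓝 L)

/-- `Δ^{α/2} f(x) = d_α p.v. ∫ (f(x+y) - f(x)) / |y|^(1+α) dy`; meaningful when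
`FracLaplacianExists α f x` holds. -/
def fracLaplacian (α : ℝ) (f : ℝ → ℝ) (x : ℝ) : ℝ :=
  dConst α * limUnder (𝓝[>] (0 : ℝ)) (truncatedIntegral α f x)

/-- `p(1 - e^{-t}, y - e^{-t/α} x) (h(y) - μ(h))`. -/
def steinIntegrand (α : ℝ) (μ : Measure ℝ) (h : ℝ → ℝ) (x t y : ℝ) : ℝ :=
  stableDensity α (1 - Real.exp (-t)) (y - Real.exp (-t / α) * x) * (h y - ∫ z, h z ∂μ)

/-- The solution of Stein's equation `Δ^{α/2} f(x) - x f'(x) / α = h(x) - μ(h)` given by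
`f(x) = -∫_0^∞ ∫_ℝ p(1 - e^{-t}, y - e^{-t/α} x) (h(y) - μ(h)) dy dt`. -/
def steinSolution (α : ℝ) (μ : Measure ℝ) (h : ℝ → ℝ) (x : ℝ) : ℝ :=
  -∫ t in Ioi (0 : ℝ), ∫ y : ℝ, steinIntegrand α μ h x t y

/-- All the integrals in the formula for `steinSolution` converge absolutely. -/
def SteinSolutionWellDefined (α : ℝ) (μ : Measure ℝ) (h : ℝ → ℝ) : Prop :=
  Integrable h μ ∧
  (∀ x t : ℝ, 0 < t → Integrable (steinIntegrand α μ h x t)) ∧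
  ∀ x : ℝ, IntegrableOn (fun t => ∫ y : ℝ, steinIntegrand α μ h x t y) (Ioi (0 : ℝ))

/-- `‖h'‖ = sup_x |h'(x)|`. For a Lipschitz `h` the set is bounded; `deriv h` is `0` where `h` is
not differentiable, so the supremum is effectively over the (full measure) set of points of
differentiability, and it equals the smallest Lipschitz constant of `h`. -/
def derivNorm (h : ℝ → ℝ) : ℝ := ⨆ x : ℝ, |deriv h x|

end StableStein

end

/-! With `σ = (1 - e^{-t})^{1/α}`, self-similarity turns the inner integral into `E h(e^{-t/α} x + σ
Z) - μ(h)` with `Z ∼ μ` (`steinMean`). As a function of `x` this is the convolution-type smoothing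
of the `‖h'‖σ`-Lipschitz function `w ↦ h(σ w)` by the fixed kernel `p(1, ·)`, evaluated at `b x`
with `b = e^{-t/α}/σ`. One increment is absorbed by the Lipschitz bound and the others by the
kernel, so increments of order one, two and three are controlled by the `L¹` norms of `p`, `p'` and
`p''` (`incrementBounds_steinMean`). Those of `p'` and `p''` come from `|g| ≤ a` and `x²|g| ≤ b`,
which give `∫ |g| ≤ 4√(ab)`; the decay is two integrations by parts in the Fourier integral.

Folding `y ↦ -y` writes the principal value as an absolutely convergent integral of symmetric second
differences over `(0, ∞)`. For fixed `t`, the difference of these integrals at `x` and `x'` is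
bounded both by `U` and by `U · b|x - x'|`, with `U = ‖h'‖ σ C b^α`, by cutting the `y`-integral at
`1/b`. Hence it is at most `U (b|x - x'|)^γ` (`lintegral_symmDiff₂_sub_le`). Since `σ b^{α+γ} =
e^{-(α+γ)t/α} (1 - e^{-t})^{(1-γ)/α - 1}`, integrating in `t` produces the Beta function
(`lintegral_symmDiff₂_steinSolution_le`).

Separately, Fourier inversion and uniqueness of characteristic functions identify `p(1, ·)` as the
density of `μ`, and a tail estimate gives `μ` a first moment. -/

namespace StableStein

/-! ### The profiles `u^β e^{-u^α}`. -/

/-- The function `u ^ β * exp (-u ^ α)`. -/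
noncomputable def powExp (α β u : ℝ) : ℝ := u ^ β * Real.exp (-u ^ α)

theorem powExp_nonneg (α β : ℝ) {u : ℝ} (hu : 0 ≤ u) : 0 ≤ powExp α β u := by
  unfold powExp; positivity

theorem integrableOn_powExp {α β : ℝ} (hα : 0 < α) (hβ : -1 < β) :
    IntegrableOn (powExp α β) (Ioi 0) :=
  integrableOn_rpow_mul_exp_neg_rpow hβ hα

theorem integral_powExp {α β : ℝ} (hα : 0 < α) (hβ : -1 < β) :
    ∫ u in Ioi (0 : ℝ), powExp α β u = 1 / α * Real.Gamma ((β + 1) / α) :=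
  integral_rpow_mul_exp_neg_rpow hα hβ

theorem hasDerivAt_powExp (α β : ℝ) {u : ℝ} (hu : 0 < u) :
    HasDerivAt (powExp α β) (β * powExp α (β - 1) u - α * powExp α (β + α - 1) u) u := by
  have h1 := Real.hasDerivAt_rpow_const (x := u) (p := β) (Or.inl hu.ne')
  have h2 := (Real.hasDerivAt_rpow_const (x := u) (p := α) (Or.inl hu.ne')).neg.exp
  refine (h1.mul h2).congr_deriv ?_
  simp only [powExp, Pi.neg_apply]
  rw [show β + α - 1 = β + (α - 1) by ring, Real.rpow_add hu]
  ring

theorem tendsto_powExp_atTop {α : ℝ} (hα : 0 < α) (β : ℝ) :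
    Tendsto (powExp α β) atTop (𝓝 0) := by
  have h := (tendsto_rpow_mul_exp_neg_mul_atTop_nhds_zero (β / α) 1 one_pos).comp
    (tendsto_rpow_atTop hα)
  refine h.congr' ?_
  filter_upwards [eventually_gt_atTop 0] with u hu
  simp only [Function.comp, powExp]
  rw [← Real.rpow_mul hu.le, mul_div_cancel₀ _ hα.ne', neg_mul, one_mul]

theorem continuous_powExp {α β : ℝ} (hα : 0 < α) (hβ : 0 ≤ β) : Continuous (powExp α β) := by
  unfold powExp
  exact (Real.continuous_rpow_const hβ).mul
    (Real.continuous_exp.comp (Real.continuous_rpow_const hα.le).neg)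

theorem tendsto_powExp_zero {α β : ℝ} (hα : 0 < α) (hβ : 0 < β) :
    Tendsto (powExp α β) (𝓝[>] 0) (𝓝 0) := by
  have h := (continuous_powExp hα hβ.le).tendsto 0
  have h0 : powExp α β 0 = 0 := by simp [powExp, Real.zero_rpow hβ.ne']
  rw [h0] at h
  exact h.mono_left nhdsWithin_le_nhds

theorem tendsto_powExp_zero_zero {α : ℝ} (hα : 0 < α) :
    Tendsto (powExp α 0) (𝓝[>] 0) (𝓝 1) := by
  have h := (continuous_powExp hα le_rfl).tendsto 0
  have h0 : powExp α 0 0 = 1 := by simp [powExp, Real.zero_rpow hα.ne']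
  rw [h0] at h
  exact h.mono_left nhdsWithin_le_nhds

/-! ### Integration by parts against `cos (u x)` and `sin (u x)`. -/

theorem tendsto_mul_cos_zero {l : Filter ℝ} {q : ℝ → ℝ} (hq : Tendsto q l (𝓝 0)) (x : ℝ) :
    Tendsto (q * fun u => Real.cos (u * x)) l (𝓝 0) := by
  refine squeeze_zero_norm (fun u => ?_) (tendsto_zero_iff_norm_tendsto_zero.1 hq)
  simp only [Pi.mul_apply, norm_mul]
  exact mul_le_of_le_one_right (norm_nonneg _) (Real.abs_cos_le_one _)

theorem tendsto_mul_sin_zero {l : Filter ℝ} {q : ℝ → ℝ} (hq : Tendsto q l (𝓝 0)) (x : ℝ) :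
    Tendsto (q * fun u => Real.sin (u * x)) l (𝓝 0) := by
  refine squeeze_zero_norm (fun u => ?_) (tendsto_zero_iff_norm_tendsto_zero.1 hq)
  simp only [Pi.mul_apply, norm_mul]
  exact mul_le_of_le_one_right (norm_nonneg _) (Real.abs_sin_le_one _)

theorem tendsto_mul_sin_nhdsGT {q : ℝ → ℝ} {A : ℝ} (hq : Tendsto q (𝓝[>] 0) (𝓝 A)) (x : ℝ) :
    Tendsto (q * fun u => Real.sin (u * x)) (𝓝[>] 0) (𝓝 0) := by
  have h : Continuous fun u : ℝ => Real.sin (u * x) := by fun_prop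
  have h1 := (h.tendsto 0).mono_left (nhdsWithin_le_nhds (s := Ioi 0))
  simpa using! hq.mul h1

theorem integrableOn_mul_cos {s : Set ℝ} {q : ℝ → ℝ} (hq : IntegrableOn q s) (x : ℝ) :
    IntegrableOn (fun u => q u * Real.cos (u * x)) s :=
  Integrable.mul_bdd (c := 1) hq (by fun_prop) (ae_of_all _ fun u => Real.abs_cos_le_one _)

theorem integrableOn_mul_sin {s : Set ℝ} {q : ℝ → ℝ} (hq : IntegrableOn q s) (x : ℝ) :
    IntegrableOn (fun u => q u * Real.sin (u * x)) s :=
  Integrable.mul_bdd (c := 1) hq (by fun_prop) (ae_of_all _ fun u => Real.abs_sin_le_one _)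

theorem abs_integral_mul_cos_le {s : Set ℝ} {q : ℝ → ℝ} (hq : IntegrableOn q s) (x : ℝ) :
    |∫ u in s, q u * Real.cos (u * x)| ≤ ∫ u in s, |q u| := by
  rw [← Real.norm_eq_abs]
  refine norm_integral_le_of_norm_le hq.abs (ae_of_all _ fun u => ?_)
  rw [norm_mul]
  exact mul_le_of_le_one_right (norm_nonneg _) (Real.abs_cos_le_one _)

theorem abs_integral_mul_sin_le {s : Set ℝ} {q : ℝ → ℝ} (hq : IntegrableOn q s) (x : ℝ) :
    |∫ u in s, q u * Real.sin (u * x)| ≤ ∫ u in s, |q u| := by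
  rw [← Real.norm_eq_abs]
  refine norm_integral_le_of_norm_le hq.abs (ae_of_all _ fun u => ?_)
  rw [norm_mul]
  exact mul_le_of_le_one_right (norm_nonneg _) (Real.abs_sin_le_one _)

theorem hasDerivAt_sin_mul (x u : ℝ) :
    HasDerivAt (fun u => Real.sin (u * x)) (x * Real.cos (u * x)) u := by
  simpa [mul_comm] using ((hasDerivAt_id u).mul_const x).sin

theorem hasDerivAt_cos_mul (x u : ℝ) :
    HasDerivAt (fun u => Real.cos (u * x)) (-x * Real.sin (u * x)) u := by
  simpa [mul_comm] using ((hasDerivAt_id u).mul_const x).cos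

/-- The boundary term at `0` carries `sin 0 = 0`, so any finite limit `A` is allowed; the sine
version below needs limit `0`. -/
theorem mul_integral_mul_cos {q q' : ℝ → ℝ} {A : ℝ} (hq : ∀ u ∈ Ioi (0 : ℝ), HasDerivAt q (q' u) u)
    (hi : IntegrableOn q (Ioi 0)) (hi' : IntegrableOn q' (Ioi 0))
    (h0 : Tendsto q (𝓝[>] 0) (𝓝 A)) (h1 : Tendsto q atTop (𝓝 0)) (x : ℝ) :
    x * ∫ u in Ioi (0 : ℝ), q u * Real.cos (u * x) =
      -∫ u in Ioi (0 : ℝ), q' u * Real.sin (u * x) := by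
  have h := integral_Ioi_mul_deriv_eq_deriv_mul (u := q) (u' := q')
    (v := fun u => Real.sin (u * x)) (v' := fun u => x * Real.cos (u * x)) hq
    (fun u _ => hasDerivAt_sin_mul x u)
    (((integrableOn_mul_cos hi x).const_mul x).congr (ae_of_all _ fun u => by
      simp only [Pi.mul_apply]; ring))
    (integrableOn_mul_sin hi' x) (tendsto_mul_sin_nhdsGT h0 x) (tendsto_mul_sin_zero h1 x)
  rw [← integral_const_mul]
  simp only [sub_self, zero_sub] at h
  rw [← h]
  exact integral_congr_ae (ae_of_all _ fun u => by ring)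

theorem mul_integral_mul_sin {q q' : ℝ → ℝ} (hq : ∀ u ∈ Ioi (0 : ℝ), HasDerivAt q (q' u) u)
    (hi : IntegrableOn q (Ioi 0)) (hi' : IntegrableOn q' (Ioi 0))
    (h0 : Tendsto q (𝓝[>] 0) (𝓝 0)) (h1 : Tendsto q atTop (𝓝 0)) (x : ℝ) :
    x * ∫ u in Ioi (0 : ℝ), q u * Real.sin (u * x) =
      ∫ u in Ioi (0 : ℝ), q' u * Real.cos (u * x) := by
  have h := integral_Ioi_mul_deriv_eq_deriv_mul (u := q) (u' := q')
    (v := fun u => Real.cos (u * x)) (v' := fun u => -x * Real.sin (u * x)) hq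
    (fun u _ => hasDerivAt_cos_mul x u)
    (((integrableOn_mul_sin hi x).const_mul (-x)).congr (ae_of_all _ fun u => by
      simp only [Pi.mul_apply]; ring))
    (integrableOn_mul_cos hi' x) (tendsto_mul_cos_zero h0 x) (tendsto_mul_cos_zero h1 x)
  rw [← integral_const_mul]
  simp only [sub_self, zero_sub] at h
  rw [← neg_inj, ← h, ← integral_neg]
  exact integral_congr_ae (ae_of_all _ fun u => by ring)

/-- Two integrations by parts turn the factor `x²` into `q''`. Only the step that differentiates
`cos` requires its amplitude to vanish at `0`: here it is `q'`, in the sine case `q`. -/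
theorem sq_mul_abs_integral_mul_cos_le {q q' q'' : ℝ → ℝ} {A : ℝ}
    (hq : ∀ u ∈ Ioi (0 : ℝ), HasDerivAt q (q' u) u)
    (hq' : ∀ u ∈ Ioi (0 : ℝ), HasDerivAt q' (q'' u) u)
    (hi : IntegrableOn q (Ioi 0)) (hi' : IntegrableOn q' (Ioi 0)) (hi'' : IntegrableOn q'' (Ioi 0))
    (h0 : Tendsto q (𝓝[>] 0) (𝓝 A)) (h1 : Tendsto q atTop (𝓝 0))
    (h0' : Tendsto q' (𝓝[>] 0) (𝓝 0)) (h1' : Tendsto q' atTop (𝓝 0)) (x : ℝ) :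
    x ^ 2 * |∫ u in Ioi (0 : ℝ), q u * Real.cos (u * x)| ≤ ∫ u in Ioi (0 : ℝ), |q'' u| := by
  rw [← abs_of_nonneg (sq_nonneg x), ← abs_mul, sq, mul_assoc, mul_integral_mul_cos hq hi hi' h0 h1,
    mul_neg, abs_neg, mul_integral_mul_sin hq' hi' hi'' h0' h1']
  exact abs_integral_mul_cos_le hi'' x

theorem sq_mul_abs_integral_mul_sin_le {q q' q'' : ℝ → ℝ} {B : ℝ}
    (hq : ∀ u ∈ Ioi (0 : ℝ), HasDerivAt q (q' u) u)
    (hq' : ∀ u ∈ Ioi (0 : ℝ), HasDerivAt q' (q'' u) u)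
    (hi : IntegrableOn q (Ioi 0)) (hi' : IntegrableOn q' (Ioi 0)) (hi'' : IntegrableOn q'' (Ioi 0))
    (h0 : Tendsto q (𝓝[>] 0) (𝓝 0)) (h1 : Tendsto q atTop (𝓝 0))
    (h0' : Tendsto q' (𝓝[>] 0) (𝓝 B)) (h1' : Tendsto q' atTop (𝓝 0)) (x : ℝ) :
    x ^ 2 * |∫ u in Ioi (0 : ℝ), q u * Real.sin (u * x)| ≤ ∫ u in Ioi (0 : ℝ), |q'' u| := by
  rw [← abs_of_nonneg (sq_nonneg x), ← abs_mul, sq, mul_assoc, mul_integral_mul_sin hq hi hi' h0 h1,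
    mul_integral_mul_cos hq' hi' hi'' h0' h1', abs_neg]
  exact abs_integral_mul_sin_le hi'' x

/-! ### Cosine and sine transforms and their derivatives. -/

/-- `∫_0^∞ u ^ β cos (u x) exp (-u ^ α) du`. -/
noncomputable def cosTransform (α β x : ℝ) : ℝ :=
  ∫ u in Ioi (0 : ℝ), powExp α β u * Real.cos (u * x)

/-- `∫_0^∞ u ^ β sin (u x) exp (-u ^ α) du`. -/
noncomputable def sinTransform (α β x : ℝ) : ℝ :=
  ∫ u in Ioi (0 : ℝ), powExp α β u * Real.sin (u * x)

theorem powExp_add_one (α β : ℝ) {u : ℝ} (hu : 0 < u) :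
    powExp α (β + 1) u = u * powExp α β u := by
  unfold powExp; rw [Real.rpow_add hu, Real.rpow_one]; ring

theorem hasDerivAt_cosTransform {α β : ℝ} (hα : 0 < α) (hβ : -1 < β) (x : ℝ) :
    HasDerivAt (cosTransform α β) (-sinTransform α (β + 1) x) x := by
  have hm : ∀ γ : ℝ, -1 < γ → AEStronglyMeasurable (powExp α γ) (volume.restrict (Ioi 0)) :=
    fun γ hγ => (integrableOn_powExp hα hγ).aestronglyMeasurable
  have h := (hasDerivAt_integral_of_dominated_loc_of_deriv_le (μ := volume.restrict (Ioi (0 : ℝ)))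
    (F := fun x u => powExp α β u * Real.cos (u * x))
    (F' := fun x u => -(powExp α (β + 1) u * Real.sin (u * x))) (x₀ := x) (s := univ)
    (bound := powExp α (β + 1)) univ_mem
    (Eventually.of_forall fun y => (hm β hβ).mul (by fun_prop))
    (integrableOn_mul_cos (integrableOn_powExp hα hβ) x)
    ((hm (β + 1) (by linarith)).mul (by fun_prop)).neg
    ?_ (integrableOn_powExp hα (by linarith)) ?_).2
  · refine h.congr_deriv ?_
    rw [integral_neg]; rfl
  · refine (ae_restrict_iff' measurableSet_Ioi).2 (ae_of_all _ fun u hu y _ => ?_)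
    rw [norm_neg, norm_mul, Real.norm_of_nonneg (powExp_nonneg _ _ (le_of_lt hu))]
    exact mul_le_of_le_one_right (powExp_nonneg _ _ (le_of_lt hu)) (Real.abs_sin_le_one _)
  · refine (ae_restrict_iff' measurableSet_Ioi).2 (ae_of_all _ fun u hu y _ => ?_)
    have h2 := ((hasDerivAt_id y).const_mul u).cos.const_mul (powExp α β u)
    refine h2.congr_deriv ?_
    rw [powExp_add_one _ _ hu]; simp; ring

theorem hasDerivAt_sinTransform {α β : ℝ} (hα : 0 < α) (hβ : -1 < β) (x : ℝ) :
    HasDerivAt (sinTransform α β) (cosTransform α (β + 1) x) x := by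
  have hm : ∀ γ : ℝ, -1 < γ → AEStronglyMeasurable (powExp α γ) (volume.restrict (Ioi 0)) :=
    fun γ hγ => (integrableOn_powExp hα hγ).aestronglyMeasurable
  have h := (hasDerivAt_integral_of_dominated_loc_of_deriv_le (μ := volume.restrict (Ioi (0 : ℝ)))
    (F := fun x u => powExp α β u * Real.sin (u * x))
    (F' := fun x u => powExp α (β + 1) u * Real.cos (u * x)) (x₀ := x) (s := univ)
    (bound := powExp α (β + 1)) univ_mem
    (Eventually.of_forall fun y => (hm β hβ).mul (by fun_prop))
    (integrableOn_mul_sin (integrableOn_powExp hα hβ) x)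
    ((hm (β + 1) (by linarith)).mul (by fun_prop))
    ?_ (integrableOn_powExp hα (by linarith)) ?_).2
  · exact h
  · refine (ae_restrict_iff' measurableSet_Ioi).2 (ae_of_all _ fun u hu y _ => ?_)
    rw [norm_mul, Real.norm_of_nonneg (powExp_nonneg _ _ (le_of_lt hu))]
    exact mul_le_of_le_one_right (powExp_nonneg _ _ (le_of_lt hu)) (Real.abs_cos_le_one _)
  · refine (ae_restrict_iff' measurableSet_Ioi).2 (ae_of_all _ fun u hu y _ => ?_)
    have h2 := ((hasDerivAt_id y).const_mul u).sin.const_mul (powExp α β u)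
    refine h2.congr_deriv ?_
    rw [powExp_add_one _ _ hu]; simp; ring

theorem continuous_cosTransform {α β : ℝ} (hα : 0 < α) (hβ : -1 < β) :
    Continuous (cosTransform α β) :=
  continuous_iff_continuousAt.2 fun x => (hasDerivAt_cosTransform hα hβ x).continuousAt

theorem continuous_sinTransform {α β : ℝ} (hα : 0 < α) (hβ : -1 < β) :
    Continuous (sinTransform α β) :=
  continuous_iff_continuousAt.2 fun x => (hasDerivAt_sinTransform hα hβ x).continuousAt

theorem setIntegral_abs_powExp {α β : ℝ} (hα : 0 < α) (hβ : -1 < β) :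
    ∫ u in Ioi (0 : ℝ), |powExp α β u| = 1 / α * Real.Gamma ((β + 1) / α) := by
  rw [← integral_powExp hα hβ]
  exact setIntegral_congr_fun measurableSet_Ioi fun u hu =>
    abs_of_nonneg (powExp_nonneg _ _ (le_of_lt hu))

theorem abs_cosTransform_le {α β : ℝ} (hα : 0 < α) (hβ : -1 < β) (x : ℝ) :
    |cosTransform α β x| ≤ 1 / α * Real.Gamma ((β + 1) / α) :=
  (abs_integral_mul_cos_le (integrableOn_powExp hα hβ) x).trans_eq (setIntegral_abs_powExp hα hβ)

theorem abs_sinTransform_le {α β : ℝ} (hα : 0 < α) (hβ : -1 < β) (x : ℝ) :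
    |sinTransform α β x| ≤ 1 / α * Real.Gamma ((β + 1) / α) :=
  (abs_integral_mul_sin_le (integrableOn_powExp hα hβ) x).trans_eq (setIntegral_abs_powExp hα hβ)

/-! ### Quadratic decay with explicit constants. -/

theorem integral_abs_combination_le {f g k : ℝ → ℝ} {s : Set ℝ} (hf : IntegrableOn f s)
    (hg : IntegrableOn g s) (hk : IntegrableOn k s) (a b c : ℝ) :
    ∫ u in s, |a * f u + b * g u + c * k u| ≤
      |a| * (∫ u in s, |f u|) + |b| * (∫ u in s, |g u|) + |c| * (∫ u in s, |k u|) := by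
  have hfg : Integrable (fun u => |a| * |f u| + |b| * |g u|) (volume.restrict s) :=
    (hf.abs.const_mul _).add (hg.abs.const_mul _)
  rw [← integral_const_mul, ← integral_const_mul, ← integral_const_mul, ← integral_add
    (hf.abs.const_mul _) (hg.abs.const_mul _), ← integral_add hfg (hk.abs.const_mul _)]
  refine integral_mono (((hf.const_mul _).add (hg.const_mul _)).add (hk.const_mul _)).abs
    (((hf.abs.const_mul _).add (hg.abs.const_mul _)).add (hk.abs.const_mul _)) fun u => ?_
  rw [← abs_mul, ← abs_mul, ← abs_mul]
  exact abs_add_three _ _ _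

theorem Gamma_le_one_of_mem {x : ℝ} (h1 : 1 ≤ x) (h2 : x ≤ 2) : Real.Gamma x ≤ 1 := by
  have h := Real.convexOn_Gamma.le_max_of_mem_Icc (x := 1) (y := 2) (z := x)
    (by simp) (by simp) ⟨h1, h2⟩
  simpa [Real.Gamma_two] using h

theorem Gamma_le_two_of_mem {x : ℝ} (h1 : 1 ≤ x) (h2 : x ≤ 3) : Real.Gamma x ≤ 2 := by
  have h := Real.convexOn_Gamma.le_max_of_mem_Icc (x := 1) (y := 3) (z := x)
    (by simp) (by simp) ⟨h1, h2⟩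
  have h3 : Real.Gamma 3 = 2 := by
    rw [show (3 : ℝ) = 2 + 1 by norm_num, Real.Gamma_add_one (by norm_num), Real.Gamma_two]; norm_num
  rw [h3] at h
  simpa using h

/-- Since `α > 1`, the first derivative of `e^{-u^α}` vanishes at `0` and the second, of order
`u^{α-2}` there, is integrable. No explicit constant is needed: this only serves to show that the
density is integrable. -/
theorem sq_mul_abs_cosTransform_zero_le {α : ℝ} (h1 : 1 < α) :
    ∃ b : ℝ, 0 < b ∧ ∀ x, x ^ 2 * |cosTransform α 0 x| ≤ b := by
  have hα : 0 < α := by linarith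
  have hI : ∀ β : ℝ, -1 < β → IntegrableOn (powExp α β) (Ioi 0) := fun β => integrableOn_powExp hα
  let q'' : ℝ → ℝ := fun u =>
    -α * ((α - 1) * powExp α (α - 1 - 1) u - α * powExp α (α - 1 + α - 1) u)
  refine ⟨(∫ u in Ioi (0 : ℝ), |q'' u|) + 1,
    add_pos_of_nonneg_of_pos (integral_nonneg fun _ => abs_nonneg _) one_pos, fun x => ?_⟩
  refine (sq_mul_abs_integral_mul_cos_le (q := powExp α 0)
    (q' := fun u => -α * powExp α (α - 1) u) (q'' := q'') (A := 1) (fun u hu => ?_)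
    (fun u hu => (hasDerivAt_powExp α (α - 1) hu).const_mul _) (hI _ (by linarith))
    ((hI _ (by linarith)).const_mul _)
    ((((hI _ (by linarith)).const_mul _).sub ((hI _ (by linarith)).const_mul _)).const_mul _)
    (tendsto_powExp_zero_zero hα) (tendsto_powExp_atTop hα 0) ?_ ?_ x).trans (by linarith)
  · refine (hasDerivAt_powExp α 0 hu).congr_deriv ?_
    simp
  · simpa using (tendsto_powExp_zero hα (sub_pos.2 h1)).const_mul (-α)
  · simpa using (tendsto_powExp_atTop hα (α - 1)).const_mul (-α)

theorem sq_mul_abs_sinTransform_one_le {α : ℝ} (h1 : 1 < α) (x : ℝ) :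
    x ^ 2 * |sinTransform α 1 x| ≤ 2 * α + 1 := by
  have hα : 0 < α := by linarith
  have hI : ∀ β : ℝ, -1 < β → IntegrableOn (powExp α β) (Ioi 0) := fun β => integrableOn_powExp hα
  let q'' : ℝ → ℝ := fun u =>
    -- The zero term only gives the three-term shape of `integral_abs_combination_le`. The other two
    -- contribute `(1 + α) Γ(1) + α Γ(2) = 2α + 1`.
    (-(α * (1 + α))) * powExp α (α - 1) u + α ^ 2 * powExp α (2 * α - 1) u + 0 * powExp α 0 u
  have hq'' : IntegrableOn q'' (Ioi 0) :=
    (((hI _ (by linarith)).const_mul _).add ((hI _ (by linarith)).const_mul _)).add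
      ((hI _ (by linarith)).const_mul _)
  refine (sq_mul_abs_integral_mul_sin_le (q := powExp α 1)
    (q' := fun u => powExp α 0 u - α * powExp α α u) (q'' := q'') (B := 1) (fun u hu => ?_)
    (fun u hu => ?_) (hI _ (by linarith)) ((hI _ (by linarith)).sub ((hI _ (by linarith)).const_mul _))
    hq'' (tendsto_powExp_zero hα one_pos) (tendsto_powExp_atTop hα 1) ?_ ?_ x).trans ?_
  · refine (hasDerivAt_powExp α 1 hu).congr_deriv ?_
    simp
  · refine ((hasDerivAt_powExp α 0 hu).sub ((hasDerivAt_powExp α α hu).const_mul α)).congr_deriv ?_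
    simp only [q'']
    rw [show α + α - 1 = 2 * α - 1 by ring, show 0 + α - 1 = α - 1 by ring]
    ring
  · simpa using (tendsto_powExp_zero_zero hα).sub ((tendsto_powExp_zero hα hα).const_mul α)
  · simpa using (tendsto_powExp_atTop hα 0).sub ((tendsto_powExp_atTop hα α).const_mul α)
  · refine (integral_abs_combination_le (hI _ (by linarith)) (hI _ (by linarith))
      (hI _ (by linarith)) _ _ _).trans_eq ?_
    rw [setIntegral_abs_powExp hα (by linarith), setIntegral_abs_powExp hα (by linarith),
      show (α - 1 + 1) / α = 1 by field_simp; ring, show (2 * α - 1 + 1) / α = 2 by field_simp; ring,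
      Real.Gamma_one, Real.Gamma_two, abs_neg, abs_of_pos (by positivity),
      abs_of_pos (by positivity)]
    simp; field_simp; ring

theorem sq_mul_abs_cosTransform_two_le {α : ℝ} (h1 : 1 < α) (x : ℝ) :
    x ^ 2 * |cosTransform α 2 x| ≤ 2 * α + 6 := by
  have hα : 0 < α := by linarith
  have hI : ∀ β : ℝ, -1 < β → IntegrableOn (powExp α β) (Ioi 0) := fun β => integrableOn_powExp hα
  let q'' : ℝ → ℝ := fun u =>
    2 * powExp α 0 u + (-(α * (α + 3))) * powExp α α u + α ^ 2 * powExp α (2 * α) u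
  have hq'' : IntegrableOn q'' (Ioi 0) :=
    (((hI _ (by linarith)).const_mul _).add ((hI _ (by linarith)).const_mul _)).add
      ((hI _ (by linarith)).const_mul _)
  refine (sq_mul_abs_integral_mul_cos_le (q := powExp α 2)
    (q' := fun u => 2 * powExp α 1 u - α * powExp α (α + 1) u) (q'' := q'') (A := 0)
    (fun u hu => ?_) (fun u hu => ?_) (hI _ (by linarith))
    (((hI _ (by linarith)).const_mul _).sub ((hI _ (by linarith)).const_mul _))
    hq'' (tendsto_powExp_zero hα two_pos) (tendsto_powExp_atTop hα 2) ?_ ?_ x).trans ?_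
  · refine (hasDerivAt_powExp α 2 hu).congr_deriv ?_
    rw [show (2 : ℝ) - 1 = 1 by norm_num, show 2 + α - 1 = α + 1 by ring]
  · refine (((hasDerivAt_powExp α 1 hu).const_mul 2).sub
      ((hasDerivAt_powExp α (α + 1) hu).const_mul α)).congr_deriv ?_
    simp only [q'']
    rw [show α + 1 + α - 1 = 2 * α by ring, show 1 + α - 1 = α by ring,
      show α + 1 - 1 = α by ring, sub_self]
    ring
  · simpa using ((tendsto_powExp_zero hα one_pos).const_mul 2).sub
      ((tendsto_powExp_zero hα (by linarith : 0 < α + 1)).const_mul α)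
  · simpa using ((tendsto_powExp_atTop hα 1).const_mul 2).sub
      ((tendsto_powExp_atTop hα (α + 1)).const_mul α)
  · refine (integral_abs_combination_le (hI _ (by linarith)) (hI _ (by linarith))
      (hI _ (by linarith)) _ _ _).trans ?_
    rw [setIntegral_abs_powExp hα (by linarith), setIntegral_abs_powExp hα (by linarith),
      setIntegral_abs_powExp hα (by linarith), show (0 + 1) / α = 1 / α by ring,
      show (α + 1) / α = 1 / α + 1 by field_simp; ring, show (2 * α + 1) / α = 1 / α + 1 + 1 by field_simp; ring,
      Real.Gamma_add_one (s := 1 / α + 1) (by positivity), abs_neg, abs_of_pos (by positivity),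
      abs_of_pos (by positivity : 0 < α * (α + 3)), abs_of_pos (by positivity : 0 < α ^ 2)]
    -- All three terms become multiples of `Γ(1/α + 1)`, with coefficients `2`, `α + 3` and `α + 1`.
    have hG : Real.Gamma (1 / α) = α * Real.Gamma (1 / α + 1) := by
      rw [Real.Gamma_add_one (by positivity)]; field_simp
    have h2 : Real.Gamma (1 / α + 1) ≤ 1 := by
      refine Gamma_le_one_of_mem ?_ ?_
      · linarith [show 0 < 1 / α by positivity]
      · linarith [(div_le_one hα).2 h1.le]
    rw [hG]
    calc _ = (2 * α + 6) * Real.Gamma (1 / α + 1) := by field_simp; ring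
      _ ≤ _ := mul_le_of_le_one_right (by positivity) h2

/-! ### From pointwise decay to `L¹` bounds. -/

theorem integrable_comp_abs {f : ℝ → ℝ} (hf : IntegrableOn f (Ioi 0)) :
    Integrable fun x : ℝ => f |x| := by
  have h1 : IntegrableOn (fun x : ℝ => f |x|) (Ioi 0) :=
    hf.congr_fun (fun x hx => by rw [abs_of_pos hx]) measurableSet_Ioi
  have h2 : IntegrableOn (fun x : ℝ => f |x|) (Iic 0) := by
    rw [← Measure.map_neg_eq_self (volume : Measure ℝ)]
    have m : MeasurableEmbedding fun x : ℝ => -x := (Homeomorph.neg ℝ).measurableEmbedding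
    rw [m.integrableOn_map_iff]
    simp_rw [Function.comp_def, abs_neg, neg_preimage, neg_Iic, neg_zero]
    exact Iff.mpr integrableOn_Ici_iff_integrableOn_Ioi h1
  simpa [Iic_union_Ioi] using h2.union h1

/-- A measurable function with `|g| ≤ a` and `x ^ 2 * |g x| ≤ b` is integrable, with
`∫ |g| ≤ 4 √(a b)`. -/
theorem integral_abs_le_of_decay {g : ℝ → ℝ} {a b : ℝ} (hg : AEStronglyMeasurable g volume)
    (ha : 0 < a) (hb : 0 < b) (h1 : ∀ x, |g x| ≤ a) (h2 : ∀ x, x ^ 2 * |g x| ≤ b) :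
    Integrable g ∧ ∫ x, |g x| ≤ 4 * Real.sqrt (a * b) := by
  -- The crossover point of the two bounds, `a = b / c²`. Each of the two pieces on the half-line
  -- then equals `√(ab)`, and symmetry doubles the sum.
  set c := Real.sqrt (b / a) with hc
  have hc0 : 0 < c := by positivity
  let B : ℝ → ℝ := fun u => (Iic c).indicator (fun _ => a) u + (Ioi c).indicator (fun u => b * u ^ (-2 : ℝ)) u
  have hi1 : IntegrableOn ((Iic c).indicator (fun _ => a)) (Ioi 0) := by
    rw [IntegrableOn, integrable_indicator_iff measurableSet_Iic, IntegrableOn,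
      Measure.restrict_restrict measurableSet_Iic, Iic_inter_Ioi]
    exact (integrableOn_const (by simp))
  have hi2 : IntegrableOn ((Ioi c).indicator (fun u => b * u ^ (-2 : ℝ))) (Ioi 0) := by
    rw [IntegrableOn, integrable_indicator_iff measurableSet_Ioi, IntegrableOn,
      Measure.restrict_restrict measurableSet_Ioi, Ioi_inter_Ioi, sup_eq_left.2 hc0.le]
    exact (integrableOn_Ioi_rpow_of_lt (by norm_num) hc0).const_mul b
  have hB : ∫ u in Ioi (0 : ℝ), B u = a * c + b / c := by
    rw [integral_add hi1 hi2, integral_indicator measurableSet_Iic, integral_indicator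
      measurableSet_Ioi, Measure.restrict_restrict measurableSet_Iic, Iic_inter_Ioi,
      Measure.restrict_restrict measurableSet_Ioi, Ioi_inter_Ioi, sup_eq_left.2 hc0.le,
      integral_const_mul, integral_Ioi_rpow_of_lt (by norm_num) hc0]
    simp [hc0.le]
    rw [show (-2 + 1 : ℝ) = -1 by norm_num, Real.rpow_neg_one]
    field_simp
  have hBi : Integrable fun x : ℝ => B |x| := integrable_comp_abs (hi1.add hi2)
  have hle : ∀ x, |g x| ≤ B |x| := by
    intro x
    by_cases hx : |x| ≤ c
    · simp only [B]
      rw [indicator_of_mem (by exact hx), indicator_of_notMem (by simpa using hx), add_zero]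
      exact h1 x
    · push Not at hx
      have hx0 : 0 < |x| := hc0.trans hx
      simp only [B]
      rw [indicator_of_notMem (by simpa using hx), indicator_of_mem (by exact hx), zero_add,
        Real.rpow_neg hx0.le, ← div_eq_mul_inv, le_div_iff₀ (by positivity), mul_comm]
      simpa using h2 x
  refine ⟨hBi.mono' hg (ae_of_all _ hle), ?_⟩
  calc ∫ x, |g x| ≤ ∫ x, B |x| :=
        integral_mono_of_nonneg (ae_of_all _ fun _ => abs_nonneg _) hBi (ae_of_all _ hle)
    _ = 2 * (a * c + b / c) := by rw [integral_comp_abs, hB]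
    _ = 4 * Real.sqrt (a * b) := by
        have e1 : a * c = Real.sqrt (a * b) := by
          have e : a * b = a * c * (a * c) := by
            rw [mul_mul_mul_comm, hc, Real.mul_self_sqrt (by positivity)]
            field_simp
          rw [e, Real.sqrt_mul_self (by positivity)]
        have e2 : b / c = a * c := by
          rw [div_eq_iff hc0.ne', mul_assoc, hc, Real.mul_self_sqrt (by positivity)]
          field_simp
        rw [e2, e1]; ring

/-! ### The stable density: derivatives, `L¹` norms, scaling. -/

theorem stableDensity_one (α x : ℝ) :
    stableDensity α 1 x = Real.pi⁻¹ * cosTransform α 0 x := by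
  have h := integral_comp_abs (f := fun u => powExp α 0 u * Real.cos (u * x))
  have e : ∀ u : ℝ, powExp α 0 |u| * Real.cos (|u| * x) =
      Real.cos (u * x) * Real.exp (-1 * |u| ^ α) := fun u => by
    have : Real.cos (|u| * x) = Real.cos (u * x) := by
      rw [← Real.cos_abs (u * x), ← Real.cos_abs (|u| * x), abs_mul, abs_mul, abs_abs]
    rw [this]; simp [powExp, mul_comm]
  simp only [e] at h
  rw [stableDensity, h, cosTransform, mul_inv]
  ring

theorem hasDerivAt_stableDensity_one {α : ℝ} (hα : 0 < α) (x : ℝ) :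
    HasDerivAt (stableDensity α 1) (-(Real.pi⁻¹ * sinTransform α 1 x)) x := by
  have h := (hasDerivAt_cosTransform hα (by norm_num : (-1 : ℝ) < 0) x).const_mul Real.pi⁻¹
  rw [zero_add] at h
  rw [show stableDensity α 1 = fun x => Real.pi⁻¹ * cosTransform α 0 x from
    funext (stableDensity_one α)]
  exact h.congr_deriv (by ring)

theorem continuous_stableDensity_one {α : ℝ} (hα : 0 < α) : Continuous (stableDensity α 1) :=
  continuous_iff_continuousAt.2 fun x => (hasDerivAt_stableDensity_one hα x).continuousAt

theorem integrable_stableDensity_one {α : ℝ} (h1 : 1 < α) : Integrable (stableDensity α 1) := by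
  have hα : 0 < α := by linarith
  obtain ⟨b, hb, h⟩ := sq_mul_abs_cosTransform_zero_le h1
  have := (integral_abs_le_of_decay (continuous_cosTransform hα (by norm_num)).aestronglyMeasurable
    (a := 1 / α * Real.Gamma ((0 + 1) / α))
    (mul_pos (by positivity) (Real.Gamma_pos_of_pos (by positivity))) hb
    (abs_cosTransform_le hα (by norm_num)) h).1
  rw [show stableDensity α 1 = fun x => Real.pi⁻¹ * cosTransform α 0 x from
    funext (stableDensity_one α)]
  exact this.const_mul _

/-- The sup bound is `Γ(2/α)/α ≤ 1/α`, because `2/α ∈ [1, 2]`. For the cosine transform below it is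
`Γ(3/α)/α ≤ 2/α`, because `3/α ∈ [1, 3]`. -/
theorem integral_abs_sinTransform_one_le {α : ℝ} (h1 : 1 < α) (h2 : α < 2) :
    Integrable (sinTransform α 1) ∧
      ∫ x, |sinTransform α 1 x| ≤ 4 * Real.sqrt ((2 * α + 1) / α) := by
  have hα : 0 < α := by linarith
  have h := integral_abs_le_of_decay (g := sinTransform α 1) (a := 1 / α) (b := 2 * α + 1)
    (continuous_sinTransform hα (by norm_num)).aestronglyMeasurable (by positivity) (by positivity)
    (fun x => (abs_sinTransform_le hα (by norm_num) x).trans ?_) (sq_mul_abs_sinTransform_one_le h1)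
  · rwa [show 1 / α * (2 * α + 1) = (2 * α + 1) / α by ring] at h
  · refine mul_le_of_le_one_right (by positivity) (Gamma_le_one_of_mem ?_ ?_)
    · rw [le_div_iff₀ hα]; linarith
    · rw [div_le_iff₀ hα]; linarith

theorem integral_abs_cosTransform_two_le {α : ℝ} (h1 : 1 < α) (h2 : α < 2) :
    Integrable (cosTransform α 2) ∧
      ∫ x, |cosTransform α 2 x| ≤ 8 * Real.sqrt ((α + 3) / α) := by
  have hα : 0 < α := by linarith
  have h := integral_abs_le_of_decay (g := cosTransform α 2) (a := 1 / α * 2) (b := 2 * α + 6)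
    (continuous_cosTransform hα (by norm_num)).aestronglyMeasurable (by positivity) (by positivity)
    (fun x => (abs_cosTransform_le hα (by norm_num) x).trans ?_) (sq_mul_abs_cosTransform_two_le h1)
  · rwa [show 1 / α * 2 * (2 * α + 6) = 2 ^ 2 * ((α + 3) / α) by ring,
      Real.sqrt_mul (by norm_num), Real.sqrt_sq (by norm_num), ← mul_assoc,
      show (4 : ℝ) * 2 = 8 by norm_num] at h
  · refine mul_le_mul_of_nonneg_left (Gamma_le_two_of_mem ?_ ?_) (by positivity)
    · rw [le_div_iff₀ hα]; linarith
    · rw [div_le_iff₀ hα]; linarith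

theorem stableDensity_rpow {α σ : ℝ} (hσ : 0 < σ) (x : ℝ) :
    stableDensity α (σ ^ α) x = σ⁻¹ * stableDensity α 1 (x / σ) := by
  have h := Measure.integral_comp_mul_left
    (fun v => Real.cos (v * (x / σ)) * Real.exp (-1 * |v| ^ α)) σ
  rw [smul_eq_mul, abs_of_pos (inv_pos.2 hσ)] at h
  rw [stableDensity, stableDensity, mul_left_comm, ← h]
  congr 1
  refine integral_congr_ae (ae_of_all _ fun u => ?_)
  simp only []
  rw [abs_mul, abs_of_pos hσ, Real.mul_rpow hσ.le (abs_nonneg _)]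
  congr 2
  · field_simp
  · ring

/-! ### Fourier inversion and identification of `μ`. -/

theorem integral_abs_comp_exp {α : ℝ} (hα : 0 < α) :
    Integrable fun u : ℝ => Real.exp (-|u| ^ α) :=
  (integrable_comp_abs (f := fun u => Real.exp (-u ^ α))
    ((integrableOn_powExp hα (β := 0) (by norm_num)).congr_fun (fun u _ => by simp [powExp])
      measurableSet_Ioi))

theorem integral_sin_mul_exp (α x : ℝ) :
    ∫ u : ℝ, Real.sin (u * x) * Real.exp (-|u| ^ α) = 0 := by
  have h := integral_neg_eq_self (fun u : ℝ => Real.sin (u * x) * Real.exp (-|u| ^ α)) volume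
  simp only [neg_mul, Real.sin_neg, abs_neg, integral_neg] at h
  linarith

theorem integral_cexp_mul_exp {α : ℝ} (hα : 0 < α) (x : ℝ) :
    ∫ u : ℝ, Complex.exp (-(u * x : ℝ) * Complex.I) * (Real.exp (-|u| ^ α) : ℂ) =
      ((2 * Real.pi * stableDensity α 1 x : ℝ) : ℂ) := by
  have hi := integral_abs_comp_exp hα
  have e : ∀ u : ℝ, Complex.exp (-(u * x : ℝ) * Complex.I) * (Real.exp (-|u| ^ α) : ℂ) =
      ((Real.cos (u * x) * Real.exp (-|u| ^ α) : ℝ) : ℂ) -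
        ((Real.sin (u * x) * Real.exp (-|u| ^ α) : ℝ) : ℂ) * Complex.I := fun u => by
    rw [← Complex.ofReal_neg, Complex.exp_mul_I, ← Complex.ofReal_cos, ← Complex.ofReal_sin,
      Real.cos_neg, Real.sin_neg]
    push_cast; ring
  simp only [e]
  have h1 : Integrable fun u : ℝ => Real.cos (u * x) * Real.exp (-|u| ^ α) :=
    hi.bdd_mul (c := 1) (by fun_prop) (ae_of_all _ fun u => Real.abs_cos_le_one _)
  have h2 : Integrable fun u : ℝ => Real.sin (u * x) * Real.exp (-|u| ^ α) :=
    hi.bdd_mul (c := 1) (by fun_prop) (ae_of_all _ fun u => Real.abs_sin_le_one _)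
  rw [integral_sub h1.ofReal (h2.ofReal.mul_const _), integral_mul_const, integral_complex_ofReal,
    integral_complex_ofReal, integral_sin_mul_exp, stableDensity, mul_inv_cancel_left₀ (by positivity)]
  simp

open FourierTransform in
/-- Fourier inversion for the stable density. -/
theorem integral_cexp_mul_stableDensity {α : ℝ} (h1 : 1 < α) (t : ℝ) :
    ∫ x : ℝ, Complex.exp (t * x * Complex.I) * (stableDensity α 1 x : ℂ) =
      ((Real.exp (-|t| ^ α) : ℝ) : ℂ) := by
  have hα : 0 < α := by linarith
  -- The dilation by `2π` matches the kernel `e^{-2πi u x}` of `𝓕`, so that `𝓕 φ` is exactly the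
  -- density.
  let φ : ℝ → ℂ := fun u => (Real.exp (-|2 * Real.pi * u| ^ α) : ℂ)
  have hφc : Continuous φ := by
    have : Continuous fun u : ℝ => |2 * Real.pi * u| ^ α :=
      (Real.continuous_rpow_const hα.le).comp (by fun_prop : Continuous fun u : ℝ => |2 * Real.pi * u|)
    exact Complex.continuous_ofReal.comp (Real.continuous_exp.comp this.neg)
  have hφi : Integrable φ :=
    ((integral_abs_comp_exp hα).comp_mul_left' (R := 2 * Real.pi) (by positivity)).ofReal
  have hF : 𝓕 φ = fun x => (stableDensity α 1 x : ℂ) := by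
    funext x
    rw [Real.fourier_real_eq_integral_exp_smul]
    have h := Measure.integral_comp_mul_left
      (fun u : ℝ => Complex.exp (-(u * x : ℝ) * Complex.I) * (Real.exp (-|u| ^ α) : ℂ)) (2 * Real.pi)
    rw [integral_cexp_mul_exp hα, abs_of_pos (by positivity)] at h
    calc _ = ∫ v : ℝ, Complex.exp (-((2 * Real.pi * v) * x : ℝ) * Complex.I) *
          (Real.exp (-|2 * Real.pi * v| ^ α) : ℂ) := by
          refine integral_congr_ae (ae_of_all _ fun v => ?_)
          simp only [φ, smul_eq_mul]
          congr 2
          push_cast; ring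
      _ = _ := by
          rw [h, Complex.real_smul, ← Complex.ofReal_mul, inv_mul_cancel_left₀ (by positivity)]
  have hinv := congrFun (hφc.fourierInv_fourier_eq hφi
    (by rw [hF]; exact (integrable_stableDensity_one h1).ofReal)) (t / (2 * Real.pi))
  rw [hF, Real.fourierInv_eq'] at hinv
  have e : φ (t / (2 * Real.pi)) = ((Real.exp (-|t| ^ α) : ℝ) : ℂ) := by
    simp only [φ]
    rw [mul_div_cancel₀ _ (by positivity)]
  rw [← e, ← hinv]
  refine integral_congr_ae (ae_of_all _ fun v => ?_)
  simp only [smul_eq_mul]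
  congr 2
  have hp : (Real.pi : ℂ) ≠ 0 := by exact_mod_cast Real.pi_ne_zero
  simp
  field_simp

variable {α : ℝ} {μ : Measure ℝ}

/-- Adding the negative part of the density to `μ` gives its positive part. -/
theorem IsStandardStable.add_withDensity_eq (hμ : IsStandardStable α μ) (h1 : 1 < α) :
    μ + volume.withDensity (fun x => ENNReal.ofReal (-stableDensity α 1 x)) =
      volume.withDensity (fun x => ENNReal.ofReal (stableDensity α 1 x)) := by
  have hα : 0 < α := by linarith
  have := hμ.1
  have hpi := integrable_stableDensity_one h1
  have hpm := (continuous_stableDensity_one hα).measurable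
  have : IsFiniteMeasure (volume.withDensity fun x => ENNReal.ofReal (stableDensity α 1 x)) :=
    isFiniteMeasure_withDensity_ofReal hpi.2
  have : IsFiniteMeasure (volume.withDensity fun x => ENNReal.ofReal (-stableDensity α 1 x)) :=
    isFiniteMeasure_withDensity_ofReal hpi.neg.2
  refine Measure.ext_of_charFun (funext fun t => ?_)
  have hb : ∀ x : ℝ, ‖Complex.exp (t * x * Complex.I)‖ ≤ 1 := fun x => by
    rw [← Complex.ofReal_mul, Complex.norm_exp_ofReal_mul_I]
  have hI : ∀ ν : Measure ℝ, IsFiniteMeasure ν →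
      Integrable (fun x : ℝ => Complex.exp (t * x * Complex.I)) ν := fun ν _ =>
    Integrable.of_bound (by fun_prop) 1 (ae_of_all _ hb)
  have hW : ∀ f : ℝ → ℝ, Measurable f →
      (∫ x : ℝ, Complex.exp (t * x * Complex.I) ∂volume.withDensity fun x => ENNReal.ofReal (f x)) =
        ∫ x : ℝ, ((max (f x) 0 : ℝ) : ℂ) * Complex.exp (t * x * Complex.I) := fun f hf => by
    rw [integral_withDensity_eq_integral_toReal_smul (by fun_prop)
      (ae_of_all _ fun x => ENNReal.ofReal_lt_top)]
    refine integral_congr_ae (ae_of_all _ fun x => ?_)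
    simp only [Complex.real_smul, ENNReal.toReal_ofReal']
  have hM : ∀ f : ℝ → ℝ, Integrable f →
      Integrable fun x : ℝ => ((max (f x) 0 : ℝ) : ℂ) * Complex.exp (t * x * Complex.I) :=
    fun f hfi => Integrable.mul_bdd (c := 1) hfi.pos_part.ofReal (by fun_prop) (ae_of_all _ hb)
  have h := hμ.2 t
  rw [charFun_apply_real] at h ⊢
  rw [charFun_apply_real, integral_add_measure (hI _ inferInstance) (hI _ inferInstance), h,
    hW _ hpm, hW (fun x => -stableDensity α 1 x) hpm.neg, ← integral_cexp_mul_stableDensity h1,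
    ← eq_sub_iff_add_eq, ← integral_sub (hM _ hpi) (hM (fun x => -stableDensity α 1 x) hpi.neg)]
  refine integral_congr_ae (ae_of_all _ fun x => ?_)
  simp only []
  rw [← sub_mul, ← Complex.ofReal_sub, max_zero_sub_max_neg_zero_eq_self, mul_comm]

/-- The defining cosine integral does not reveal its sign. But the positive part has no mass where
the density is negative, and it dominates the negative part by `add_withDensity_eq`, so the negative
part vanishes. -/
theorem IsStandardStable.ae_stableDensity_nonneg (hμ : IsStandardStable α μ) (h1 : 1 < α) :
    ∀ᵐ x : ℝ, 0 ≤ stableDensity α 1 x := by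
  have hα : 0 < α := by linarith
  have hpm := (continuous_stableDensity_one hα).measurable
  have h := hμ.add_withDensity_eq h1
  have hs : MeasurableSet {x : ℝ | stableDensity α 1 x < 0} :=
    measurableSet_lt hpm measurable_const
  have h2 : (volume.withDensity (fun x => ENNReal.ofReal (-stableDensity α 1 x)))
      {x : ℝ | stableDensity α 1 x < 0} = 0 := by
    have h3 : (volume.withDensity (fun x => ENNReal.ofReal (stableDensity α 1 x)))
        {x : ℝ | stableDensity α 1 x < 0} = 0 := by
      rw [withDensity_apply _ hs]
      exact setLIntegral_eq_zero hs fun x hx => ENNReal.ofReal_of_nonpos (le_of_lt hx)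
    rw [← h, Measure.add_apply] at h3
    exact (add_eq_zero.1 h3).2
  rw [withDensity_apply _ hs, setLIntegral_eq_zero_iff hs
    (show Measurable fun x => ENNReal.ofReal (-stableDensity α 1 x) from hpm.neg.ennreal_ofReal)] at h2
  filter_upwards [h2] with x hx
  by_contra hc
  have := hx (not_le.1 hc)
  rw [ENNReal.ofReal_eq_zero] at this
  linarith [not_le.1 hc]

theorem IsStandardStable.eq_withDensity (hμ : IsStandardStable α μ) (h1 : 1 < α) :
    μ = volume.withDensity (fun x => ENNReal.ofReal (stableDensity α 1 x)) := by
  have h := hμ.add_withDensity_eq h1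
  have h0 : volume.withDensity (fun x => ENNReal.ofReal (-stableDensity α 1 x)) = 0 := by
    rw [← withDensity_zero (μ := volume)]
    refine withDensity_congr_ae ?_
    filter_upwards [hμ.ae_stableDensity_nonneg h1] with x hx
    exact ENNReal.ofReal_of_nonpos (by linarith)
  rwa [h0, add_zero] at h

theorem IsStandardStable.integrable_iff (hμ : IsStandardStable α μ) (h1 : 1 < α) {g : ℝ → ℝ} :
    Integrable g μ ↔ Integrable fun x => stableDensity α 1 x * g x := by
  have hα : 0 < α := by linarith
  have hpm := (continuous_stableDensity_one hα).measurable
  rw [hμ.eq_withDensity h1, integrable_withDensity_iff_integrable_smul' hpm.ennreal_ofReal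
    (ae_of_all _ fun x => ENNReal.ofReal_lt_top)]
  refine integrable_congr ?_
  filter_upwards [hμ.ae_stableDensity_nonneg h1] with x hx
  rw [ENNReal.toReal_ofReal hx, smul_eq_mul]

theorem IsStandardStable.integral_eq (hμ : IsStandardStable α μ) (h1 : 1 < α) (g : ℝ → ℝ) :
    ∫ x, g x ∂μ = ∫ x, stableDensity α 1 x * g x := by
  have hα : 0 < α := by linarith
  have hpm := (continuous_stableDensity_one hα).measurable
  rw [hμ.eq_withDensity h1, integral_withDensity_eq_integral_toReal_smul hpm.ennreal_ofReal
    (ae_of_all _ fun x => ENNReal.ofReal_lt_top)]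
  refine integral_congr_ae ?_
  filter_upwards [hμ.ae_stableDensity_nonneg h1] with x hx
  rw [ENNReal.toReal_ofReal hx, smul_eq_mul]

/-! ### Tails and first moment of `μ`. -/

/-- Tails are controlled by the characteristic function near `0`, where `1 - e^{-|t|^α} ≤ |t|^α ≤
(2/r)^α`. -/
theorem IsStandardStable.measureReal_abs_gt_le (hμ : IsStandardStable α μ) (hα : 0 < α)
    {r : ℝ} (hr : 0 < r) : μ.real {x | r < |x|} ≤ 2 * 2 ^ α * r ^ (-α) := by
  have := hμ.1
  refine (measureReal_abs_gt_le_integral_charFun hr).trans ?_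
  have h : ‖∫ t in (-2 * r⁻¹)..(2 * r⁻¹), 1 - charFun μ t‖ ≤
      (2 * r⁻¹) ^ α * |2 * r⁻¹ - -2 * r⁻¹| := by
    refine intervalIntegral.norm_integral_le_of_norm_le_const fun t ht => ?_
    rw [neg_mul, uIoc_of_le (by linarith [show 0 < 2 * r⁻¹ by positivity])] at ht
    have ht' : |t| ≤ 2 * r⁻¹ := abs_le.2 ⟨ht.1.le, ht.2⟩
    rw [hμ.2 t, ← Complex.ofReal_one, ← Complex.ofReal_sub, Complex.norm_real, Real.norm_eq_abs,
      abs_of_nonneg (sub_nonneg.2 (Real.exp_le_one_iff.2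
        (neg_nonpos.2 (Real.rpow_nonneg (abs_nonneg _) _))))]
    have := Real.add_one_le_exp (-|t| ^ α)
    have h2 := Real.rpow_le_rpow (abs_nonneg t) ht' hα.le
    linarith
  refine (mul_le_mul_of_nonneg_left h (by positivity)).trans_eq ?_
  rw [Real.mul_rpow (by norm_num) (by positivity), Real.inv_rpow hr.le, Real.rpow_neg hr.le,
    show 2 * r⁻¹ - -2 * r⁻¹ = 4 * r⁻¹ by ring, abs_of_pos (by positivity)]
  field_simp
  norm_num

/-- Layer-cake formula: the tail is at most `1` on `(0, 1]` and of order `r^{-α}` beyond, integrable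
since `α > 1`. -/
theorem IsStandardStable.integrable_id (hμ : IsStandardStable α μ) (h1 : 1 < α) :
    Integrable (fun x : ℝ => x) μ := by
  have := hμ.1
  have hα : 0 < α := by linarith
  refine ⟨by fun_prop, ?_⟩
  rw [hasFiniteIntegral_iff_norm]
  rw [lintegral_eq_lintegral_meas_lt μ (ae_of_all _ fun x => norm_nonneg x) (by fun_prop)]
  rw [← Ioc_union_Ioi_eq_Ioi (zero_le_one' ℝ)]
  refine (lintegral_union_le _ _ _).trans_lt (ENNReal.add_lt_top.2 ⟨?_, ?_⟩)
  · refine (lintegral_mono (g := fun _ => 1) fun t => prob_le_one).trans_lt ?_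
    simp
  · have hfin : IntegrableOn (fun r : ℝ => 2 * 2 ^ α * r ^ (-α)) (Ioi 1) :=
      (integrableOn_Ioi_rpow_of_lt (by linarith) one_pos).const_mul _
    refine (setLIntegral_mono' measurableSet_Ioi fun r hr => ?_).trans_lt
      hfin.lintegral_lt_top
    have h := hμ.measureReal_abs_gt_le hα (one_pos.trans hr)
    rw [measureReal_def] at h
    exact (ENNReal.le_ofReal_iff_toReal_le (measure_ne_top _ _) (by
      have := one_pos.trans (mem_Ioi.1 hr); positivity)).2 h

/-! ### Smoothing and increments up to order three. -/

/-- `L¹`-continuity of translations for a function with integrable derivative. -/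
theorem integral_abs_translate_sub_le {g g' : ℝ → ℝ} (hg : ∀ x, HasDerivAt g (g' x) x)
    (hc : Continuous g') (hi : Integrable g) (hi' : Integrable g') (δ : ℝ) :
    ∫ x, |g (x + δ) - g x| ≤ |δ| * ∫ x, |g' x| := by
  -- The fundamental theorem of calculus along the segment; Tonelli and translation invariance then
  -- remove the dependence on `s`.
  have hpt : ∀ x, ‖g (x + δ) - g x‖ₑ ≤ ∫⁻ s in Ioc (0 : ℝ) 1, ‖δ * g' (x + s * δ)‖ₑ := by
    intro x
    have h : ∫ s in (0 : ℝ)..1, δ * g' (x + s * δ) = g (x + 1 * δ) - g (x + 0 * δ) := by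
      refine intervalIntegral.integral_eq_sub_of_hasDerivAt (f := fun s => g (x + s * δ))
        (fun s _ => ?_) (Continuous.intervalIntegrable (by fun_prop) _ _)
      have h1 : HasDerivAt (fun s : ℝ => x + s * δ) δ s := by
        simpa using ((hasDerivAt_id s).mul_const δ).const_add x
      exact ((hg (x + s * δ)).comp s h1).congr_deriv (mul_comm _ _)
    rw [one_mul, zero_mul, add_zero] at h
    rw [← h, intervalIntegral.integral_of_le zero_le_one]
    exact enorm_integral_le_lintegral_enorm _
  have hmeas : Measurable fun q : ℝ × ℝ => ‖δ * g' (q.1 + q.2 * δ)‖ₑ :=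
    (by fun_prop : Continuous fun q : ℝ × ℝ => δ * g' (q.1 + q.2 * δ)).measurable.enorm
  have hlin : ∫⁻ x, ‖g (x + δ) - g x‖ₑ ≤ ENNReal.ofReal (|δ| * ∫ x, |g' x|) := by
    calc ∫⁻ x, ‖g (x + δ) - g x‖ₑ
        ≤ ∫⁻ x, ∫⁻ s in Ioc (0 : ℝ) 1, ‖δ * g' (x + s * δ)‖ₑ := lintegral_mono hpt
      _ = ∫⁻ s in Ioc (0 : ℝ) 1, ∫⁻ x, ‖δ * g' (x + s * δ)‖ₑ :=
          lintegral_lintegral_swap hmeas.aemeasurable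
      _ = ∫⁻ s in Ioc (0 : ℝ) 1, ENNReal.ofReal (|δ| * ∫ x, |g' x|) := by
          refine lintegral_congr fun s => ?_
          rw [lintegral_add_right_eq_self (fun x => ‖δ * g' x‖ₑ) (s * δ)]
          rw [← ofReal_integral_norm_eq_lintegral_enorm (hi'.const_mul δ)]
          simp only [norm_mul, Real.norm_eq_abs, integral_const_mul]
      _ = _ := by simp
  have hnn : 0 ≤ |δ| * ∫ x, |g' x| :=
    mul_nonneg (abs_nonneg _) (integral_nonneg fun _ => abs_nonneg _)
  have hint : Integrable fun x => g (x + δ) - g x := (hi.comp_add_right δ).sub hi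
  rw [← ofReal_integral_norm_eq_lintegral_enorm hint] at hlin
  exact (ENNReal.ofReal_le_ofReal_iff hnn).1 hlin

/-- The smoothing `X ↦ ∫ q(z) H(X + z) dz`. -/
noncomputable def smoothing (q H : ℝ → ℝ) (X : ℝ) : ℝ := ∫ z, q z * H (X + z)

theorem abs_smoothing_le {q H : ℝ → ℝ} {C : ℝ} (hq : Integrable q) (hC : ∀ x, |H x| ≤ C)
    (X : ℝ) : |smoothing q H X| ≤ C * ∫ z, |q z| := by
  rw [← integral_const_mul, ← Real.norm_eq_abs]
  refine norm_integral_le_of_norm_le (hq.abs.const_mul C) (ae_of_all _ fun z => ?_)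
  rw [norm_mul, mul_comm]
  exact mul_le_mul_of_nonneg_right (hC _) (norm_nonneg _)

/-- Translation invariance moves the increment from the rough factor `H` to the smooth kernel `q`.
-/
theorem smoothing_add_sub {q H : ℝ → ℝ} {C : ℝ} (hq : Integrable q) (hH : Continuous H)
    (hC : ∀ x, |H x| ≤ C) (X ε : ℝ) :
    smoothing q H (X + ε) - smoothing q H X = smoothing (fun z => q (z + -ε) - q z) H X := by
  have h1 : smoothing q H (X + ε) = ∫ z, q (z + -ε) * H (X + z) := by
    rw [smoothing, ← integral_add_right_eq_self _ (-ε)]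
    refine integral_congr_ae (ae_of_all _ fun z => ?_)
    simp only []
    rw [show X + ε + (z + -ε) = X + z by ring]
  have hi : ∀ {q : ℝ → ℝ}, Integrable q → Integrable fun z => q z * H (X + z) := fun hq =>
    Integrable.mul_bdd (c := C) hq (by fun_prop) (ae_of_all _ fun z => hC _)
  rw [h1, smoothing, smoothing, ← integral_sub (hi (hq.comp_add_right (-ε))) (hi hq)]
  exact integral_congr_ae (ae_of_all _ fun z => by simp only []; ring)

/-- Bounds on the increments of `g` of the first three orders. -/
structure IncrementBounds (g : ℝ → ℝ) (c₀ c₁ c₂ : ℝ) : Prop where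
  first : ∀ X Δ : ℝ, |g (X + Δ) - g X| ≤ c₀ * |Δ|
  second : ∀ X Δ ε : ℝ, |g (X + ε + Δ) - g (X + ε) - (g (X + Δ) - g X)| ≤ c₁ * |Δ| * |ε|
  third : ∀ X Δ ε η : ℝ, |g (X + η + ε + Δ) - g (X + η + ε) - (g (X + η + Δ) - g (X + η)) -
    (g (X + ε + Δ) - g (X + ε) - (g (X + Δ) - g X))| ≤ c₂ * |Δ| * |ε| * |η|

theorem IncrementBounds.comp_mul {g : ℝ → ℝ} {c₀ c₁ c₂ : ℝ} (h : IncrementBounds g c₀ c₁ c₂)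
    {b : ℝ} (hb : 0 ≤ b) (m : ℝ) :
    IncrementBounds (fun x => g (b * x) - m) (c₀ * b) (c₁ * b ^ 2) (c₂ * b ^ 3) where
  first X Δ := by
    have := h.first (b * X) (b * Δ)
    rw [abs_mul, abs_of_nonneg hb] at this
    rw [mul_add]
    calc _ = _ := by congr 1; ring
      _ ≤ _ := this
      _ = _ := by ring
  second X Δ ε := by
    have := h.second (b * X) (b * Δ) (b * ε)
    rw [abs_mul b Δ, abs_mul b ε, abs_of_nonneg hb] at this
    simp only [mul_add]
    calc _ = _ := by congr 1; ring
      _ ≤ _ := this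
      _ = _ := by ring
  third X Δ ε η := by
    have := h.third (b * X) (b * Δ) (b * ε) (b * η)
    rw [abs_mul b Δ, abs_mul b ε, abs_mul b η, abs_of_nonneg hb] at this
    simp only [mul_add]
    calc _ = _ := by congr 1; ring
      _ ≤ _ := this
      _ = _ := by ring

/-- Smoothing a Lipschitz function by a `C²` kernel with integrable derivatives. -/
theorem incrementBounds_smoothing {p p' p'' k : ℝ → ℝ} {K M₀ M₁ M₂ : ℝ}
    (hp : ∀ x, HasDerivAt p (p' x) x) (hp' : ∀ x, HasDerivAt p' (p'' x) x) (hc : Continuous p'')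
    (hi : Integrable p) (hi' : Integrable p') (hi'' : Integrable p'')
    (h0 : ∫ x, |p x| ≤ M₀) (h1 : ∫ x, |p' x| ≤ M₁) (h2 : ∫ x, |p'' x| ≤ M₂)
    (hkc : Continuous k) (hk : ∀ x y, |k x - k y| ≤ K * |x - y|)
    (hpk : ∀ X, Integrable fun z => p z * k (X + z)) :
    IncrementBounds (smoothing p k) (K * M₀) (K * M₁) (K * M₂) := by
  have hK : 0 ≤ K := by simpa using (abs_nonneg _).trans (hk 1 0)
  have hpc' : Continuous p' := continuous_iff_continuousAt.2 fun x => (hp' x).continuousAt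
  have hH : ∀ Δ x, |k (x + Δ) - k x| ≤ K * |Δ| := fun Δ x => by simpa using hk (x + Δ) x
  have hHc : ∀ Δ, Continuous fun x => k (x + Δ) - k x := fun Δ => by fun_prop
  -- The first increment is spent on `k`. This replaces the possibly unbounded `k` by a function
  -- bounded by `K|Δ|`, so that all further increments can be moved to the kernel.
  have hD : ∀ Δ X, smoothing p k (X + Δ) - smoothing p k X =
      smoothing p (fun w => k (w + Δ) - k w) X := fun Δ X => by
    rw [smoothing, smoothing, smoothing, ← integral_sub (hpk _) (hpk _)]
    refine integral_congr_ae (ae_of_all _ fun z => ?_)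
    simp only []
    rw [show X + Δ + z = X + z + Δ by ring]; ring
  have hτ : ∀ ε, Integrable fun z => p (z + -ε) - p z := fun ε => (hi.comp_add_right _).sub hi
  have hτ' : ∀ ε, Integrable fun z => p' (z + -ε) - p' z := fun ε => (hi'.comp_add_right _).sub hi'
  have hshift : ∀ {q q' : ℝ → ℝ}, (∀ x, HasDerivAt q (q' x) x) → ∀ ε x,
      HasDerivAt (fun z => q (z + -ε) - q z) (q' (x + -ε) - q' x) x := fun hq ε x =>
    ((hq (x + -ε)).comp_add_const x (-ε)).sub (hq x)
  refine ⟨fun X Δ => ?_, fun X Δ ε => ?_, fun X Δ ε η => ?_⟩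
  · rw [hD]
    refine (abs_smoothing_le hi (hH Δ) X).trans ?_
    calc _ ≤ K * |Δ| * M₀ := mul_le_mul_of_nonneg_left h0 (by positivity)
      _ = _ := by ring
  · rw [hD, hD, smoothing_add_sub hi (hHc Δ) (hH Δ)]
    refine (abs_smoothing_le (hτ ε) (hH Δ) X).trans ?_
    have h3 := integral_abs_translate_sub_le hp hpc' hi hi' (-ε)
    rw [abs_neg] at h3
    calc _ ≤ K * |Δ| * (|ε| * M₁) := mul_le_mul_of_nonneg_left
          (h3.trans (mul_le_mul_of_nonneg_left h1 (abs_nonneg _))) (by positivity)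
      _ = _ := by ring
  · rw [hD, hD, hD, hD, smoothing_add_sub hi (hHc Δ) (hH Δ), smoothing_add_sub hi (hHc Δ) (hH Δ),
      smoothing_add_sub (hτ ε) (hHc Δ) (hH Δ)]
    refine (abs_smoothing_le (((hτ ε).comp_add_right _).sub (hτ ε)) (hH Δ) X).trans ?_
    -- The translation estimate is used twice: on the increment of `p`, whose derivative is the
    -- increment of `p'`, and then on `p'` itself.
    have h3 := integral_abs_translate_sub_le (hshift hp ε) (by fun_prop) (hτ ε) (hτ' ε) (-η)
    have h4 := integral_abs_translate_sub_le hp' hc hi' hi'' (-ε)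
    rw [abs_neg] at h3 h4
    calc _ ≤ K * |Δ| * (|η| * (|ε| * M₂)) := mul_le_mul_of_nonneg_left
          (h3.trans (mul_le_mul_of_nonneg_left
            (h4.trans (mul_le_mul_of_nonneg_left h2 (abs_nonneg _))) (abs_nonneg _)))
          (by positivity)
      _ = _ := by ring

/-! ### Symmetric second differences. -/

/-- The symmetric second difference `g (x + y) + g (x - y) - 2 g x`. -/
def symmDiff₂ (g : ℝ → ℝ) (x y : ℝ) : ℝ := g (x + y) + g (x - y) - 2 * g x

section

variable {g : ℝ → ℝ} {c₀ c₁ c₂ : ℝ}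

theorem IncrementBounds.abs_symmDiff₂_le (h : IncrementBounds g c₀ c₁ c₂) (x y : ℝ) :
    |symmDiff₂ g x y| ≤ c₁ * y ^ 2 := by
  have := h.second (x - y) y y
  rw [mul_assoc, ← sq, sq_abs, sub_add_cancel] at this
  refine le_trans (le_of_eq ?_) this
  rw [symmDiff₂]; congr 1; ring

theorem IncrementBounds.abs_symmDiff₂_le' (h : IncrementBounds g c₀ c₁ c₂) (x y : ℝ) :
    |symmDiff₂ g x y| ≤ 2 * c₀ * |y| := by
  have h1 := h.first x y
  have h2 := h.first x (-y)
  rw [abs_neg] at h2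
  have := abs_add_le (g (x + y) - g x) (g (x + -y) - g x)
  rw [symmDiff₂, show g (x + y) + g (x - y) - 2 * g x = g (x + y) - g x + (g (x + -y) - g x) by
    rw [← sub_eq_add_neg x y]; ring]
  linarith

/-- This is a third increment based at `x' - y`, with steps `y`, `y`, `x - x'`. -/
theorem IncrementBounds.abs_symmDiff₂_sub_le (h : IncrementBounds g c₀ c₁ c₂) (x x' y : ℝ) :
    |symmDiff₂ g x y - symmDiff₂ g x' y| ≤ c₂ * |x - x'| * y ^ 2 := by
  have := h.third (x' - y) y y (x - x')
  rw [mul_assoc c₂, ← sq, sq_abs, sub_add_cancel] at this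
  refine le_trans (le_of_eq ?_) (this.trans_eq (by ring))
  rw [symmDiff₂, symmDiff₂, show x' - y + (x - x') = x - y by ring, sub_add_cancel]
  congr 1; ring

/-- Sum of two mixed second increments based at `x'`, with steps `±y` and `x - x'`: linear in `y`,
hence usable for large `y`. -/
theorem IncrementBounds.abs_symmDiff₂_sub_le' (h : IncrementBounds g c₀ c₁ c₂) (x x' y : ℝ) :
    |symmDiff₂ g x y - symmDiff₂ g x' y| ≤ 2 * c₁ * |x - x'| * |y| := by
  have h1 := h.second x' y (x - x')
  have h2 := h.second x' (-y) (x - x')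
  rw [abs_neg] at h2
  rw [add_sub_cancel] at h1 h2
  have h3 := abs_add_le (g (x + y) - g x - (g (x' + y) - g x'))
    (g (x + -y) - g x - (g (x' + -y) - g x'))
  rw [symmDiff₂, symmDiff₂, sub_eq_add_neg x y, sub_eq_add_neg x' y]
  refine le_trans (le_of_eq ?_) (h3.trans (by linarith))
  congr 1; ring

end

/-! ### The singular integral at a fixed time. -/

/-- Below `ρ` the quadratic bound is integrable because `α < 2`; above `ρ` the linear one because `α
> 1`. -/
theorem lintegral_div_rpow_le {α : ℝ} (h1 : 1 < α) (h2 : α < 2) {F : ℝ → ℝ} {A B ρ : ℝ}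
    (hA : ∀ y, 0 < y → |F y| ≤ A * y ^ 2) (hB : ∀ y, 0 < y → |F y| ≤ B * y) (hρ : 0 < ρ) :
    ∫⁻ y in Ioi (0 : ℝ), ‖F y / y ^ (1 + α)‖ₑ ≤
      ENNReal.ofReal (A * ρ ^ (2 - α) / (2 - α) + B * ρ ^ (1 - α) / (α - 1)) := by
  have hA0 : 0 ≤ A := by simpa using (abs_nonneg _).trans (hA 1 one_pos)
  have hB0 : 0 ≤ B := by simpa using (abs_nonneg _).trans (hB 1 one_pos)
  have e1 : ∀ y : ℝ, 0 < y → ‖F y / y ^ (1 + α)‖ₑ ≤ ENNReal.ofReal (A * y ^ (1 - α)) := by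
    intro y hy
    rw [Real.enorm_eq_ofReal_abs, abs_div, abs_of_pos (Real.rpow_pos_of_pos hy _)]
    refine ENNReal.ofReal_le_ofReal ?_
    rw [div_le_iff₀ (Real.rpow_pos_of_pos hy _), mul_assoc, ← Real.rpow_add hy]
    have := hA y hy
    rwa [show 1 - α + (1 + α) = (2 : ℕ) by push_cast; ring, Real.rpow_natCast]
  have e2 : ∀ y : ℝ, 0 < y → ‖F y / y ^ (1 + α)‖ₑ ≤ ENNReal.ofReal (B * y ^ (-α)) := by
    intro y hy
    rw [Real.enorm_eq_ofReal_abs, abs_div, abs_of_pos (Real.rpow_pos_of_pos hy _)]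
    refine ENNReal.ofReal_le_ofReal ?_
    rw [div_le_iff₀ (Real.rpow_pos_of_pos hy _), mul_assoc, ← Real.rpow_add hy]
    have := hB y hy
    rwa [show -α + (1 + α) = 1 by ring, Real.rpow_one]
  have i1 : IntegrableOn (fun y : ℝ => A * y ^ (1 - α)) (Ioc 0 ρ) :=
    (((intervalIntegral.intervalIntegrable_rpow' (by linarith)).1)).const_mul A
  have i2 : IntegrableOn (fun y : ℝ => B * y ^ (-α)) (Ioi ρ) :=
    (integrableOn_Ioi_rpow_of_lt (by linarith) hρ).const_mul B
  have v1 : ∫ y in Ioc 0 ρ, A * y ^ (1 - α) = A * ρ ^ (2 - α) / (2 - α) := by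
    rw [← intervalIntegral.integral_of_le hρ.le, intervalIntegral.integral_const_mul,
      integral_rpow (Or.inl (by linarith)), show 1 - α + 1 = 2 - α by ring,
      Real.zero_rpow (by linarith), sub_zero, mul_div_assoc]
  have v2 : ∫ y in Ioi ρ, B * y ^ (-α) = B * ρ ^ (1 - α) / (α - 1) := by
    rw [integral_const_mul, integral_Ioi_rpow_of_lt (by linarith) hρ,
      show -α + 1 = 1 - α by ring, show α - 1 = -(1 - α) by ring, div_neg, neg_div, mul_neg,
      mul_div_assoc]
  rw [← Ioc_union_Ioi_eq_Ioi hρ.le, lintegral_union measurableSet_Ioi (Ioc_disjoint_Ioi le_rfl),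
    ← v1, ← v2, ENNReal.ofReal_add
      (setIntegral_nonneg measurableSet_Ioc fun y hy => mul_nonneg hA0 (Real.rpow_nonneg hy.1.le _))
      (setIntegral_nonneg measurableSet_Ioi fun y hy =>
        mul_nonneg hB0 (Real.rpow_nonneg (hρ.trans hy).le _)),
    ofReal_integral_eq_lintegral_ofReal i1 ((ae_restrict_iff' measurableSet_Ioc).2
      (ae_of_all _ fun y hy => mul_nonneg hA0 (Real.rpow_nonneg hy.1.le _))),
    ofReal_integral_eq_lintegral_ofReal i2 ((ae_restrict_iff' measurableSet_Ioi).2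
      (ae_of_all _ fun y hy => mul_nonneg hB0 (Real.rpow_nonneg (hρ.trans hy).le _)))]
  exact add_le_add (setLIntegral_mono' measurableSet_Ioc fun y hy => e1 y hy.1)
    (setLIntegral_mono' measurableSet_Ioi fun y hy => e2 y (hρ.trans hy))

theorem le_mul_rpow_of_le_of_le_mul {x U r γ : ℝ} (hU : 0 ≤ U) (hr : 0 ≤ r) (hγ : γ ∈ Ioo (0 : ℝ) 1)
    (h1 : x ≤ U) (h2 : x ≤ U * r) : x ≤ U * r ^ γ := by
  rcases le_total r 1 with h | h
  · refine h2.trans (mul_le_mul_of_nonneg_left ?_ hU)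
    rcases hr.eq_or_lt with rfl | hr
    · rw [Real.zero_rpow hγ.1.ne']
    · exact Real.self_le_rpow_of_le_one hr.le h hγ.2.le
  · exact h1.trans (le_mul_of_one_le_right hU (Real.one_le_rpow h hγ.1.le))

/-- The bracket in the Hölder bound. -/
noncomputable def holderConst (α : ℝ) : ℝ :=
  16 / (Real.pi * (2 - α)) * Real.sqrt ((α + 3) / α) +
    16 / (Real.pi * (α - 1)) * Real.sqrt ((2 * α + 1) / α)

/-- Bound for the `L¹` norm of the derivative of the stable density. -/
noncomputable def tvBound₁ (α : ℝ) : ℝ := 4 / Real.pi * Real.sqrt ((2 * α + 1) / α)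

/-- Bound for the `L¹` norm of the second derivative of the stable density. -/
noncomputable def tvBound₂ (α : ℝ) : ℝ := 8 / Real.pi * Real.sqrt ((α + 3) / α)

/-- The bound without `|x - x'|` must fit under the same constant as the one with it
(`tvBound₂_le`), so that interpolating between them costs nothing. -/
theorem two_mul_tvBound₁_le {α : ℝ} (h1 : 1 < α) (h2 : α < 2) :
    2 * tvBound₁ α / (2 - α) + 4 / (α - 1) ≤ holderConst α / α := by
  have hπ := Real.pi_pos
  have e1 : 2 * tvBound₁ α ≤ 16 / Real.pi * Real.sqrt ((α + 3) / α) / α := by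
    have h3 : Real.sqrt ((2 * α + 1) / α) ≤ Real.sqrt ((α + 3) / α) :=
      Real.sqrt_le_sqrt (div_le_div_of_nonneg_right (by linarith) (by linarith))
    rw [tvBound₁, le_div_iff₀ (by linarith)]
    calc _ = 8 / Real.pi * α * Real.sqrt ((2 * α + 1) / α) := by ring
      _ ≤ 8 / Real.pi * 2 * Real.sqrt ((α + 3) / α) := by gcongr
      _ = _ := by ring
  have e2 : 4 ≤ 16 / Real.pi * Real.sqrt ((2 * α + 1) / α) / α := by
    rw [le_div_iff₀ (by linarith), div_mul_eq_mul_div, le_div_iff₀ hπ]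
    -- Squared, this is `π² α³ ≤ 16 (2α + 1)`. It follows from `π² ≤ 10` and `5α³ ≤ 8 (2α + 1)`, the
    -- latter an equality at `α = 2`.
    have h3 : Real.pi * α / 4 ≤ Real.sqrt ((2 * α + 1) / α) := by
      refine Real.le_sqrt_of_sq_le ?_
      rw [le_div_iff₀ (by linarith)]
      have h4 : Real.pi ^ 2 ≤ 10 := by nlinarith [Real.pi_lt_d2]
      have h5 : α ^ 3 ≤ 4 * α := by
        nlinarith [mul_pos (mul_pos (by linarith : 0 < α) (sub_pos.2 h2)) (by linarith : 0 < 2 + α)]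
      have h6 : Real.pi ^ 2 * α ^ 3 ≤ 10 * α ^ 3 :=
        mul_le_mul_of_nonneg_right h4 (by positivity)
      have h7 : α ^ 3 * 5 ≤ 8 * (2 * α + 1) := by
        nlinarith [mul_pos (sub_pos.2 h2) (sub_pos.2 h1), mul_pos (sub_pos.2 h2) (by linarith : 0 < α)]
      nlinarith
    linarith
  have := div_le_div_of_nonneg_right e1 (by linarith : 0 ≤ 2 - α)
  have h3 := div_le_div_of_nonneg_right e2 (by linarith : 0 ≤ α - 1)
  refine (add_le_add this h3).trans_eq ?_
  have : 2 - α ≠ 0 := by linarith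
  have : α - 1 ≠ 0 := by linarith
  rw [holderConst]
  field_simp

theorem tvBound₂_le {α : ℝ} (h1 : 1 < α) (h2 : α < 2) :
    tvBound₂ α / (2 - α) + 2 * tvBound₁ α / (α - 1) ≤ holderConst α / α := by
  have hπ := Real.pi_pos
  have e1 : tvBound₂ α ≤ 16 / Real.pi * Real.sqrt ((α + 3) / α) / α := by
    rw [tvBound₂, le_div_iff₀ (by linarith)]
    calc _ = 8 / Real.pi * α * Real.sqrt ((α + 3) / α) := by ring
      _ ≤ 8 / Real.pi * 2 * Real.sqrt ((α + 3) / α) := by gcongr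
      _ = _ := by ring
  have e2 : 2 * tvBound₁ α ≤ 16 / Real.pi * Real.sqrt ((2 * α + 1) / α) / α := by
    rw [tvBound₁, le_div_iff₀ (by linarith)]
    calc _ = 8 / Real.pi * α * Real.sqrt ((2 * α + 1) / α) := by ring
      _ ≤ 8 / Real.pi * 2 * Real.sqrt ((2 * α + 1) / α) := by gcongr
      _ = _ := by ring
  have := div_le_div_of_nonneg_right e1 (by linarith : 0 ≤ 2 - α)
  have h3 := div_le_div_of_nonneg_right e2 (by linarith : 0 ≤ α - 1)
  refine (add_le_add this h3).trans_eq ?_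
  have : 2 - α ≠ 0 := by linarith
  have : α - 1 ≠ 0 := by linarith
  rw [holderConst]
  field_simp

/-- Cutting at `ρ = 1/b`, the natural length of `g`, makes both `b² ρ^{2-α}` and `b ρ^{1-α}` equal
to `b^α`. The bounds `b1` and `b2` differ by the factor `r = b|x - x'|`, and `min(1, r) ≤ r^γ`. -/
theorem IncrementBounds.lintegral_symmDiff₂_sub_le {α : ℝ} (h1 : 1 < α) (h2 : α < 2) {g : ℝ → ℝ}
    {K b : ℝ} (hK : 0 ≤ K) (hb : 0 < b)
    (h : IncrementBounds g (K * b) (K * tvBound₁ α * b ^ 2) (K * tvBound₂ α * b ^ 3))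
    {γ : ℝ} (hγ : γ ∈ Ioo (0 : ℝ) 1) (x x' : ℝ) :
    ∫⁻ y in Ioi (0 : ℝ), ‖(symmDiff₂ g x y - symmDiff₂ g x' y) / y ^ (1 + α)‖ₑ ≤
      ENNReal.ofReal (K * (holderConst α / α) * b ^ α * (b * |x - x'|) ^ γ) := by
  have hp1 : b ^ 2 * b⁻¹ ^ (2 - α) = b ^ α := by
    rw [Real.inv_rpow hb.le, ← Real.rpow_neg hb.le, ← Real.rpow_natCast b 2, ← Real.rpow_add hb]
    congr 1; push_cast; ring
  have hp2 : b * b⁻¹ ^ (1 - α) = b ^ α := by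
    rw [Real.inv_rpow hb.le, ← Real.rpow_neg hb.le]
    nth_rw 1 [← Real.rpow_one b]
    rw [← Real.rpow_add hb]
    congr 1; ring
  have hbα : 0 < b ^ α := Real.rpow_pos_of_pos hb _
  have b1 : ∫⁻ y in Ioi (0 : ℝ), ‖(symmDiff₂ g x y - symmDiff₂ g x' y) / y ^ (1 + α)‖ₑ ≤
      ENNReal.ofReal (K * (holderConst α / α) * b ^ α) := by
    refine (lintegral_div_rpow_le h1 h2 (A := 2 * (K * tvBound₁ α * b ^ 2)) (B := 4 * (K * b))
      (fun y _ => ?_) (fun y hy => ?_) (inv_pos.2 hb)).trans (ENNReal.ofReal_le_ofReal ?_)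
    · have := abs_sub (symmDiff₂ g x y) (symmDiff₂ g x' y)
      linarith [h.abs_symmDiff₂_le x y, h.abs_symmDiff₂_le x' y]
    · have := abs_sub (symmDiff₂ g x y) (symmDiff₂ g x' y)
      have h3 := h.abs_symmDiff₂_le' x y
      have h4 := h.abs_symmDiff₂_le' x' y
      rw [abs_of_pos hy] at h3 h4
      linarith
    · calc _ = K * (b ^ 2 * b⁻¹ ^ (2 - α) * (2 * tvBound₁ α / (2 - α)) +
            b * b⁻¹ ^ (1 - α) * (4 / (α - 1))) := by ring
        _ = K * b ^ α * (2 * tvBound₁ α / (2 - α) + 4 / (α - 1)) := by rw [hp1, hp2]; ring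
        _ ≤ K * b ^ α * (holderConst α / α) := by gcongr; exact two_mul_tvBound₁_le h1 h2
        _ = _ := by ring
  have b2 : ∫⁻ y in Ioi (0 : ℝ), ‖(symmDiff₂ g x y - symmDiff₂ g x' y) / y ^ (1 + α)‖ₑ ≤
      ENNReal.ofReal (K * (holderConst α / α) * b ^ α * (b * |x - x'|)) := by
    refine (lintegral_div_rpow_le h1 h2 (A := K * tvBound₂ α * b ^ 3 * |x - x'|)
      (B := 2 * (K * tvBound₁ α * b ^ 2) * |x - x'|)
      (fun y _ => h.abs_symmDiff₂_sub_le x x' y) (fun y hy => ?_) (inv_pos.2 hb)).trans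
      (ENNReal.ofReal_le_ofReal ?_)
    · have := h.abs_symmDiff₂_sub_le' x x' y
      rwa [abs_of_pos hy] at this
    · calc _ = K * (b * |x - x'|) * (b ^ 2 * b⁻¹ ^ (2 - α) * (tvBound₂ α / (2 - α)) +
            b * b⁻¹ ^ (1 - α) * (2 * tvBound₁ α / (α - 1))) := by ring
        _ = K * (b * |x - x'|) * b ^ α * (tvBound₂ α / (2 - α) + 2 * tvBound₁ α / (α - 1)) := by
            rw [hp1, hp2]; ring
        _ ≤ K * (b * |x - x'|) * b ^ α * (holderConst α / α) := by
            gcongr; exact tvBound₂_le h1 h2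
        _ = _ := by ring
  have hfin := (b1.trans_lt ENNReal.ofReal_lt_top).ne
  have hC : 0 ≤ holderConst α / α := by
    have : 0 < 2 - α := by linarith
    have : 0 < α - 1 := by linarith
    have := Real.pi_pos
    rw [holderConst]; positivity
  have hU : 0 ≤ K * (holderConst α / α) * b ^ α := by positivity
  have hr : 0 ≤ b * |x - x'| := by positivity
  rw [ENNReal.le_ofReal_iff_toReal_le hfin (by positivity)] at b1 b2 ⊢
  exact le_mul_rpow_of_le_of_le_mul hU hr hγ b1 b2

/-! ### The Lipschitz constant `‖h'‖` and the Beta integral in time. -/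

/-- A Lipschitz function is absolutely continuous, hence the integral of its derivative. -/
theorem abs_sub_le_derivNorm {h : ℝ → ℝ} {K : NNReal} (hh : LipschitzWith K h) (x y : ℝ) :
    |h x - h y| ≤ derivNorm h * |x - y| := by
  have hb : BddAbove (range fun x => |deriv h x|) :=
    ⟨K, by rintro _ ⟨x, rfl⟩; exact norm_deriv_le_of_lipschitz hh⟩
  rw [← (hh.lipschitzOnWith (s := uIcc y x)).absolutelyContinuousOnInterval.integral_deriv_eq_sub,
    ← Real.norm_eq_abs]
  exact intervalIntegral.norm_integral_le_of_norm_le_const fun t _ => le_ciSup hb t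

theorem derivNorm_nonneg (h : ℝ → ℝ) : 0 ≤ derivNorm h := Real.iSup_nonneg fun _ => abs_nonneg _

theorem dConst_nonneg (α : ℝ) : 0 ≤ dConst α :=
  inv_nonneg.2 (integral_nonneg fun y =>
    div_nonneg (by linarith [Real.cos_le_one y]) (Real.rpow_nonneg (abs_nonneg _) _))

/-- Substitute `v = 1 - e^{-t}` and use that the Beta density has total mass one. -/
theorem lintegral_exp_mul_one_sub_exp {s β : ℝ} (hs : 0 < s) (hβ : 0 < β) :
    ∫⁻ t in Ioi (0 : ℝ), ENNReal.ofReal (Real.exp (-(β * t)) * (1 - Real.exp (-t)) ^ (s - 1)) =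
      ENNReal.ofReal (ProbabilityTheory.beta s β) := by
  have hB := ProbabilityTheory.beta_pos hs hβ
  have himg : (fun t : ℝ => 1 - Real.exp (-t)) '' Ioi 0 = Ioo 0 1 := by
    ext v
    constructor
    · rintro ⟨t, ht, rfl⟩
      have := Real.exp_lt_one_iff.mpr (neg_lt_zero.2 (mem_Ioi.1 ht))
      exact ⟨by linarith, by linarith [Real.exp_pos (-t)]⟩
    · intro hv
      refine ⟨-Real.log (1 - v), ?_, ?_⟩
      · have := Real.log_neg (by linarith [hv.2] : 0 < 1 - v) (by linarith [hv.1])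
        exact neg_pos.2 this
      · simp only [neg_neg]
        rw [Real.exp_log (by linarith [hv.2])]; ring
  have h := lintegral_image_eq_lintegral_abs_deriv_mul (s := Ioi (0 : ℝ))
    (f := fun t => 1 - Real.exp (-t)) (f' := fun t => Real.exp (-t)) measurableSet_Ioi
    (fun t _ => by
      have := ((hasDerivAt_id t).neg.exp).const_sub 1
      exact (this.congr_deriv (by simp)).hasDerivWithinAt)
    (fun a _ b _ hab => by simpa using hab)
    (fun v => ENNReal.ofReal (v ^ (s - 1) * (1 - v) ^ (β - 1)))
  rw [himg] at h
  have e : ∫⁻ v in Ioo (0 : ℝ) 1, ENNReal.ofReal (v ^ (s - 1) * (1 - v) ^ (β - 1)) =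
      ENNReal.ofReal (ProbabilityTheory.beta s β) := by
    have h1 := ProbabilityTheory.lintegral_betaPDF_eq_one hs hβ
    rw [ProbabilityTheory.lintegral_betaPDF] at h1
    simp only [mul_assoc] at h1
    simp_rw [ENNReal.ofReal_mul (one_div_nonneg.2 hB.le)] at h1
    rw [lintegral_const_mul' _ _ ENNReal.ofReal_ne_top] at h1
    have h2 := congrArg (ENNReal.ofReal (ProbabilityTheory.beta s β) * ·) h1
    simp only [← mul_assoc, mul_one] at h2
    rwa [← ENNReal.ofReal_mul hB.le, mul_one_div_cancel hB.ne', ENNReal.ofReal_one, one_mul] at h2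
  rw [← e, h]
  refine setLIntegral_congr_fun measurableSet_Ioi fun t _ => ?_
  rw [abs_of_pos (Real.exp_pos _), ← ENNReal.ofReal_mul (Real.exp_pos _).le, sub_sub_cancel,
    ← Real.exp_mul, mul_left_comm, ← Real.exp_add, mul_comm]
  congr 3; ring

theorem integrableOn_exp_mul_one_sub_exp {s β : ℝ} (hs : 0 < s) (hβ : 0 < β) :
    IntegrableOn (fun t => Real.exp (-(β * t)) * (1 - Real.exp (-t)) ^ (s - 1)) (Ioi 0) := by
  refine ⟨by fun_prop, ?_⟩
  rw [hasFiniteIntegral_iff_enorm]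
  refine lt_of_eq_of_lt (setLIntegral_congr_fun measurableSet_Ioi fun t ht => ?_)
    ((lintegral_exp_mul_one_sub_exp hs hβ).trans_lt ENNReal.ofReal_lt_top)
  have := Real.exp_lt_one_iff.mpr (neg_lt_zero.2 (mem_Ioi.1 ht))
  exact Real.enorm_of_nonneg (mul_nonneg (Real.exp_pos _).le (Real.rpow_nonneg (by linarith) _))

/-! ### Principal values as integrals of symmetric differences. -/

section PrincipalValue

variable {α : ℝ} {f : ℝ → ℝ} {C₀ C₁ : ℝ}

theorem integrableOn_symmDiff₂_div (h1 : 1 < α) (h2 : α < 2) (hf : Continuous f) {x : ℝ}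
    (hf₀ : ∀ y, |symmDiff₂ f x y| ≤ C₀ * |y|) (hf₁ : ∀ y, |symmDiff₂ f x y| ≤ C₁ * y ^ 2) :
    IntegrableOn (fun y => symmDiff₂ f x y / y ^ (1 + α)) (Ioi 0) := by
  refine ⟨Measurable.aestronglyMeasurable ?_, ?_⟩
  · unfold symmDiff₂
    exact (by fun_prop : Continuous fun y => f (x + y) + f (x - y) - 2 * f x).measurable.div
      (by fun_prop)
  · rw [hasFiniteIntegral_iff_enorm]
    refine (lintegral_div_rpow_le h1 h2 (B := C₀) (fun y _ => hf₁ y) (fun y hy => ?_)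
      one_pos).trans_lt
      ENNReal.ofReal_lt_top
    simpa [abs_of_pos hy] using hf₀ y

theorem integrableOn_truncated (h1 : 1 < α) (hf : Continuous f) {x : ℝ}
    (hf₀ : ∀ y, |f (x + y) - f x| ≤ C₀ * |y|) {r : ℝ} (hr : 0 < r) :
    IntegrableOn (fun y : ℝ => (f (x + y) - f x) / |y| ^ (1 + α)) {y : ℝ | r ≤ |y|} := by
  have hs : MeasurableSet {y : ℝ | r ≤ |y|} := measurableSet_le measurable_const (by fun_prop)
  have hd : Integrable fun y : ℝ => (Ici r).indicator (fun u => C₀ * u ^ (-α)) |y| := by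
    refine integrable_comp_abs ?_
    rw [IntegrableOn, integrable_indicator_iff measurableSet_Ici, IntegrableOn,
      Measure.restrict_restrict measurableSet_Ici,
      inter_eq_left.2 (Ici_subset_Ioi.2 hr)]
    exact ((integrableOn_Ici_iff_integrableOn_Ioi).2
      (integrableOn_Ioi_rpow_of_lt (by linarith) hr)).const_mul _
  refine Integrable.mono' hd.integrableOn (Measurable.aestronglyMeasurable
    ((by fun_prop : Continuous fun y => f (x + y) - f x).measurable.div (by fun_prop)))
    ((ae_restrict_iff' hs).2 (ae_of_all _ fun y hy => ?_))
  have hy0 : 0 < |y| := hr.trans_le hy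
  rw [indicator_of_mem (by exact hy), norm_div, Real.norm_eq_abs,
    Real.norm_of_nonneg (Real.rpow_nonneg hy0.le _), div_le_iff₀ (Real.rpow_pos_of_pos hy0 _),
    mul_assoc, ← Real.rpow_add hy0, show -α + (1 + α) = 1 by ring, Real.rpow_one]
  exact hf₀ y

theorem truncatedIntegral_eq (h1 : 1 < α) (hf : Continuous f) {x : ℝ}
    (hf₀ : ∀ y, |f (x + y) - f x| ≤ C₀ * |y|) {r : ℝ} (hr : 0 < r) :
    truncatedIntegral α f x r = ∫ y in Ioi r, symmDiff₂ f x y / y ^ (1 + α) := by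
  have hset : {y : ℝ | r ≤ |y|} = Ici r ∪ Iic (-r) := by
    ext y; simp only [mem_ofPred_eq, le_abs, mem_union, mem_Ici, mem_Iic, le_neg]
  have hi := integrableOn_truncated h1 hf hf₀ hr
  rw [hset, integrableOn_union] at hi
  have hneg := integral_comp_neg_Ioi r (fun y : ℝ => (f (x + y) - f x) / |y| ^ (1 + α))
  have hineg : IntegrableOn (fun y : ℝ => (f (x + -y) - f x) / |-y| ^ (1 + α)) (Ioi r) := by
    have m : MeasurableEmbedding fun x : ℝ => -x := (Homeomorph.neg ℝ).measurableEmbedding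
    have h3 := hi.2
    rw [← Measure.map_neg_eq_self (volume : Measure ℝ), m.integrableOn_map_iff] at h3
    simp only [neg_preimage, neg_Iic, neg_neg] at h3
    exact h3.mono_set Ioi_subset_Ici_self
  rw [truncatedIntegral, hset, setIntegral_union _ measurableSet_Iic hi.1 hi.2, ← hneg,
    integral_Ici_eq_integral_Ioi, ← integral_add (hi.1.mono_set Ioi_subset_Ici_self) hineg]
  · refine setIntegral_congr_fun measurableSet_Ioi fun y hy => ?_
    simp only [symmDiff₂, abs_neg]
    rw [abs_of_pos (hr.trans hy), ← sub_eq_add_neg]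
    ring
  · rw [Set.disjoint_left]
    intro y hy hy'
    linarith [mem_Ici.1 hy, mem_Iic.1 hy']

/-- After folding, the integrand is absolutely integrable up to `0`, so the limit is mere exhaustion
of `(0, ∞)`. -/
theorem tendsto_truncatedIntegral (h1 : 1 < α) (h2 : α < 2) (hf : Continuous f) {x : ℝ}
    (hf₀ : ∀ y, |f (x + y) - f x| ≤ C₀ * |y|) (hf₁ : ∀ y, |symmDiff₂ f x y| ≤ C₁ * y ^ 2) :
    IntegrableOn (fun y => symmDiff₂ f x y / y ^ (1 + α)) (Ioi 0) ∧
    Tendsto (truncatedIntegral α f x) (𝓝[>] 0)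
      (𝓝 (∫ y in Ioi (0 : ℝ), symmDiff₂ f x y / y ^ (1 + α))) := by
  have hi := integrableOn_symmDiff₂_div h1 h2 hf (x := x) (C₀ := 2 * C₀) (fun y => ?_) hf₁
  · refine ⟨hi, ?_⟩
    have hc : AECover (volume.restrict (Ioi (0 : ℝ))) (𝓝[>] (0 : ℝ)) fun r => Ioi r :=
      aecover_Ioi_of_Ioi (tendsto_id.mono_left nhdsWithin_le_nhds)
    refine (hc.integral_tendsto_of_countably_generated hi).congr' ?_
    filter_upwards [self_mem_nhdsWithin] with r hr
    rw [truncatedIntegral_eq h1 hf hf₀ hr, Measure.restrict_restrict measurableSet_Ioi,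
      Ioi_inter_Ioi, sup_eq_left.2 (le_of_lt hr)]
  · have h3 := hf₀ y
    have h4 := hf₀ (-y)
    have h5 := abs_add_le (f (x + y) - f x) (f (x + -y) - f x)
    rw [abs_neg] at h4
    rw [symmDiff₂, show f (x + y) + f (x - y) - 2 * f x = f (x + y) - f x + (f (x + -y) - f x) by
      rw [← sub_eq_add_neg x y]; ring]
    linarith

end PrincipalValue

/-! ### The inner integral as an expectation. -/

/-- `(1 - exp (-t)) ^ (1 / α)`. -/
noncomputable def noiseScale (α t : ℝ) : ℝ := (1 - Real.exp (-t)) ^ (1 / α)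

/-- `E h (exp (-t / α) x + (1 - exp (-t)) ^ (1 / α) Z) - E h(Z)` for `Z` of law `μ`. -/
noncomputable def steinMean (α : ℝ) (μ : Measure ℝ) (h : ℝ → ℝ) (x t : ℝ) : ℝ :=
  ∫ z, (h (Real.exp (-t / α) * x + noiseScale α t * z) - ∫ z, h z ∂μ) ∂μ

variable {α : ℝ} {μ : Measure ℝ} {h : ℝ → ℝ} {L : ℝ}

theorem one_sub_exp_neg_pos {t : ℝ} (ht : 0 < t) : 0 < 1 - Real.exp (-t) :=
  sub_pos.2 (Real.exp_lt_one_iff.mpr (neg_lt_zero.2 ht))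

theorem noiseScale_pos {t : ℝ} (ht : 0 < t) : 0 < noiseScale α t :=
  Real.rpow_pos_of_pos (one_sub_exp_neg_pos ht) _

theorem noiseScale_rpow (hα : 0 < α) {t : ℝ} (ht : 0 < t) :
    noiseScale α t ^ α = 1 - Real.exp (-t) := by
  rw [noiseScale, ← Real.rpow_mul (one_sub_exp_neg_pos ht).le, one_div_mul_cancel hα.ne',
    Real.rpow_one]

theorem abs_one_sub_noiseScale_le (h1 : 1 < α) {t : ℝ} (ht : 0 < t) :
    |1 - noiseScale α t| ≤ Real.exp (-t) := by
  have h0 := one_sub_exp_neg_pos ht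
  have hle : 1 - Real.exp (-t) ≤ 1 := by linarith [Real.exp_pos (-t)]
  have hα : 0 < 1 / α := by positivity
  have hα1 : 1 / α ≤ 1 := (div_le_one (by linarith)).2 h1.le
  have e1 := Real.rpow_le_one h0.le hle hα.le
  have e2 := Real.self_le_rpow_of_le_one h0.le hle hα1
  rw [noiseScale, abs_of_nonneg (by linarith)]
  linarith

theorem continuous_noiseScale (hα : 0 < α) : Continuous (noiseScale α) :=
  (Real.continuous_rpow_const (by positivity)).comp
    (by fun_prop : Continuous fun t : ℝ => 1 - Real.exp (-t))

theorem IsStandardStable.integrable_of_lipschitz (hμ : IsStandardStable α μ) (h1 : 1 < α)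
    {k : ℝ → ℝ} (hc : Continuous k) {K : ℝ} (hk : ∀ x y, |k x - k y| ≤ K * |x - y|) :
    Integrable k μ := by
  have := hμ.1
  refine Integrable.mono' ((integrable_const |k 0|).add ((hμ.integrable_id h1).abs.const_mul K))
    hc.aestronglyMeasurable (ae_of_all _ fun z => ?_)
  have := hk z 0
  rw [sub_zero] at this
  have h3 := abs_sub_abs_le_abs_sub (k z) (k 0)
  simp only [Pi.add_apply, Real.norm_eq_abs]
  linarith

theorem abs_comp_affine_sub_le (hL : ∀ x y, |h x - h y| ≤ L * |x - y|) (c σ x y : ℝ) :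
    |h (c + σ * x) - h (c + σ * y)| ≤ L * |σ| * |x - y| := by
  refine (hL _ _).trans_eq ?_
  rw [show c + σ * x - (c + σ * y) = σ * (x - y) by ring, abs_mul, mul_assoc]

theorem IsStandardStable.integrable_comp_affine (hμ : IsStandardStable α μ) (h1 : 1 < α)
    (hc : Continuous h) (hL : ∀ x y, |h x - h y| ≤ L * |x - y|) (c σ : ℝ) :
    Integrable (fun z => h (c + σ * z)) μ :=
  hμ.integrable_of_lipschitz h1 (by fun_prop) (abs_comp_affine_sub_le hL c σ)

/-- Written to expose the substitution `z = (y - e^{-t/α} x)/σ`, which turns the kernel into the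
density of `μ`. -/
theorem steinIntegrand_eq (h1 : 1 < α) (x : ℝ) {t : ℝ} (ht : 0 < t) (y : ℝ) :
    steinIntegrand α μ h x t y = (noiseScale α t)⁻¹ *
      (stableDensity α 1 ((y - Real.exp (-t / α) * x) / noiseScale α t) *
        (h (Real.exp (-t / α) * x + noiseScale α t *
          ((y - Real.exp (-t / α) * x) / noiseScale α t)) - ∫ z, h z ∂μ)) := by
  have hσ := noiseScale_pos (α := α) ht
  rw [mul_div_cancel₀ _ hσ.ne', add_sub_cancel, steinIntegrand,
    ← noiseScale_rpow (by linarith : 0 < α) ht, stableDensity_rpow hσ, mul_assoc]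

theorem IsStandardStable.integrable_steinIntegrand (hμ : IsStandardStable α μ) (h1 : 1 < α)
    (hc : Continuous h) (hL : ∀ x y, |h x - h y| ≤ L * |x - y|) (x : ℝ) {t : ℝ} (ht : 0 < t) :
    Integrable (steinIntegrand α μ h x t) := by
  have := hμ.1
  have hσ := noiseScale_pos (α := α) ht
  have hi := (hμ.integrable_iff h1).1 ((hμ.integrable_comp_affine h1 hc hL
    (Real.exp (-t / α) * x) (noiseScale α t)).sub (integrable_const (∫ z, h z ∂μ)))
  rw [funext (steinIntegrand_eq (μ := μ) (h := h) h1 x ht)]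
  exact ((hi.comp_div hσ.ne').comp_sub_right (Real.exp (-t / α) * x)).const_mul _

theorem IsStandardStable.integral_steinIntegrand (hμ : IsStandardStable α μ) (h1 : 1 < α)
    (x : ℝ) {t : ℝ} (ht : 0 < t) :
    ∫ y, steinIntegrand α μ h x t y = steinMean α μ h x t := by
  have hσ := noiseScale_pos (α := α) ht
  rw [funext (steinIntegrand_eq (μ := μ) (h := h) h1 x ht), integral_const_mul,
    integral_sub_right_eq_self (fun y => stableDensity α 1 (y / noiseScale α t) *
        (h (Real.exp (-t / α) * x + noiseScale α t * (y / noiseScale α t)) - ∫ z, h z ∂μ)),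
    Measure.integral_comp_div (fun y => stableDensity α 1 y *
        (h (Real.exp (-t / α) * x + noiseScale α t * y) - ∫ z, h z ∂μ)),
    abs_of_pos hσ, smul_eq_mul, inv_mul_cancel_left₀ hσ.ne', steinMean]
  exact (hμ.integral_eq h1 _).symm

theorem IsStandardStable.steinSolution_eq (hμ : IsStandardStable α μ) (h1 : 1 < α) (x : ℝ) :
    steinSolution α μ h x = -∫ t in Ioi (0 : ℝ), steinMean α μ h x t := by
  rw [steinSolution]
  congr 1
  exact setIntegral_congr_fun measurableSet_Ioi fun t ht => hμ.integral_steinIntegrand h1 x ht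

theorem measurable_steinMean (hα : 0 < α) [IsProbabilityMeasure μ] (hc : Continuous h) :
    Measurable fun q : ℝ × ℝ => steinMean α μ h q.1 q.2 := by
  have hs := continuous_noiseScale hα
  have hcont : Continuous fun q : (ℝ × ℝ) × ℝ =>
      h (Real.exp (-q.1.2 / α) * q.1.1 + noiseScale α q.1.2 * q.2) - ∫ z, h z ∂μ := by fun_prop
  exact (hcont.stronglyMeasurable.integral_prod_right (ν := μ)).measurable

/-- Coupling with the same `Z`: the arguments of `h` differ by `e^{-t/α} x - (1 - σ) Z`, and `|1 -
σ| ≤ e^{-t}`. This gives integrability in `t`. -/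
theorem IsStandardStable.abs_steinMean_le (hμ : IsStandardStable α μ) (h1 : 1 < α)
    (hc : Continuous h) (hL : ∀ x y, |h x - h y| ≤ L * |x - y|) (x : ℝ) {t : ℝ} (ht : 0 < t) :
    |steinMean α μ h x t| ≤
      L * |x| * Real.exp (-(1 / α) * t) + L * (∫ z, |z| ∂μ) * Real.exp (-1 * t) := by
  have := hμ.1
  have hi := hμ.integrable_comp_affine h1 hc hL (Real.exp (-t / α) * x) (noiseScale α t)
  have hL0 : 0 ≤ L := by simpa using (abs_nonneg _).trans (hL 1 0)
  have hz := (hμ.integrable_id h1).abs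
  rw [steinMean, integral_sub hi (integrable_const _), integral_const, probReal_univ, one_smul,
    ← integral_sub hi (hμ.integrable_of_lipschitz h1 hc hL), ← Real.norm_eq_abs]
  refine (norm_integral_le_of_norm_le (((integrable_const
    (L * |x| * Real.exp (-(1 / α) * t))).add (hz.const_mul (L * Real.exp (-1 * t)))))
    (ae_of_all _ fun z => ?_)).trans_eq ?_
  · refine (hL _ _).trans ?_
    simp only [Pi.add_apply]
    have e : Real.exp (-t / α) * x + noiseScale α t * z - z =
        Real.exp (-t / α) * x + -((1 - noiseScale α t) * z) := by ring
    have e2 : |(1 - noiseScale α t) * z| ≤ Real.exp (-t) * |z| := by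
      rw [abs_mul]
      exact mul_le_mul_of_nonneg_right (abs_one_sub_noiseScale_le h1 ht) (abs_nonneg _)
    have e3 := abs_add_le (Real.exp (-t / α) * x) (-((1 - noiseScale α t) * z))
    rw [← e, abs_neg, abs_mul (Real.exp _), Real.abs_exp] at e3
    rw [show -(1 / α) * t = -t / α by ring, neg_one_mul]
    calc _ ≤ L * (Real.exp (-t / α) * |x| + Real.exp (-t) * |z|) := by gcongr; linarith
      _ = _ := by ring
  · have e := integral_add (integrable_const (μ := μ) (L * |x| * Real.exp (-(1 / α) * t)))
      (hz.const_mul (L * Real.exp (-1 * t)))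
    rw [integral_const, probReal_univ, one_smul, integral_const_mul] at e
    exact e.trans (by ring)

theorem IsStandardStable.integrableOn_steinMean (hμ : IsStandardStable α μ) (h1 : 1 < α)
    (hc : Continuous h) (hL : ∀ x y, |h x - h y| ≤ L * |x - y|) (x : ℝ) :
    IntegrableOn (steinMean α μ h x) (Ioi 0) := by
  have := hμ.1
  refine Integrable.mono' (((integrableOn_exp_mul_Ioi (a := -(1 / α))
    (neg_lt_zero.2 (by positivity)) 0).const_mul (L * |x|)).add
    ((integrableOn_exp_mul_Ioi (a := -1) (by norm_num) 0).const_mul (L * ∫ z, |z| ∂μ)))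
    ((measurable_steinMean (by linarith) hc).comp measurable_prodMk_left).aestronglyMeasurable
    ((ae_restrict_iff' measurableSet_Ioi).2 (ae_of_all _ fun t ht => ?_))
  exact hμ.abs_steinMean_le h1 hc hL x ht

/-- The scale `σ` is put into `h` instead of the kernel: the kernel is then `p(1, ·)` at all times,
the Lipschitz constant is `Lσ`, and the argument is dilated by `e^{-t/α}/σ`. -/
theorem IsStandardStable.incrementBounds_steinMean (hμ : IsStandardStable α μ) (h1 : 1 < α)
    (h2 : α < 2) (hc : Continuous h) (hL : ∀ x y, |h x - h y| ≤ L * |x - y|)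
    {t : ℝ} (ht : 0 < t) :
    IncrementBounds (fun x => steinMean α μ h x t)
      (L * noiseScale α t * (Real.exp (-t / α) / noiseScale α t))
      (L * noiseScale α t * tvBound₁ α * (Real.exp (-t / α) / noiseScale α t) ^ 2)
      (L * noiseScale α t * tvBound₂ α * (Real.exp (-t / α) / noiseScale α t) ^ 3) := by
  have := hμ.1
  have hα : 0 < α := by linarith
  have hπ := Real.pi_pos
  have hσ := noiseScale_pos (α := α) ht
  set σ := noiseScale α t with hσd
  have hs := integral_abs_sinTransform_one_le h1 h2
  have hcos := integral_abs_cosTransform_two_le h1 h2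
  have hM0 : ∫ x, |stableDensity α 1 x| ≤ 1 := by
    have h3 := hμ.integral_eq h1 (fun _ => 1)
    simp only [integral_const, probReal_univ, one_smul, mul_one] at h3
    refine le_of_eq ((integral_congr_ae ?_).trans h3.symm)
    filter_upwards [hμ.ae_stableDensity_nonneg h1] with x hx using abs_of_nonneg hx
  have hk : ∀ x y, |h (σ * x) - h (σ * y)| ≤ L * σ * |x - y| := fun x y => by
    simpa [abs_of_pos hσ] using abs_comp_affine_sub_le hL 0 σ x y
  have hpk : ∀ X, Integrable fun z => stableDensity α 1 z * h (σ * (X + z)) := fun X => by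
    simp only [mul_add]
    exact (hμ.integrable_iff h1).1 (hμ.integrable_comp_affine h1 hc hL (σ * X) σ)
  have hsm := incrementBounds_smoothing (p := stableDensity α 1)
    (p' := fun x => -(Real.pi⁻¹ * sinTransform α 1 x))
    (p'' := fun x => -(Real.pi⁻¹ * cosTransform α 2 x)) (k := fun w => h (σ * w)) (K := L * σ)
    (M₀ := 1) (M₁ := tvBound₁ α) (M₂ := tvBound₂ α)
    (hasDerivAt_stableDensity_one hα)
    (fun x => by
      have h3 := ((hasDerivAt_sinTransform hα (by norm_num : (-1 : ℝ) < 1) x).const_mul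
        Real.pi⁻¹).neg
      rwa [show (1 : ℝ) + 1 = 2 by norm_num] at h3)
    ((continuous_cosTransform hα (by norm_num)).const_mul _).neg
    (integrable_stableDensity_one h1) (hs.1.const_mul _).neg (hcos.1.const_mul _).neg hM0
    (by
      simp only [abs_neg, abs_mul, abs_of_pos (inv_pos.2 hπ), integral_const_mul]
      calc _ ≤ Real.pi⁻¹ * (4 * Real.sqrt ((2 * α + 1) / α)) := by gcongr; exact hs.2
        _ = _ := by rw [tvBound₁]; ring)
    (by
      simp only [abs_neg, abs_mul, abs_of_pos (inv_pos.2 hπ), integral_const_mul]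
      calc _ ≤ Real.pi⁻¹ * (8 * Real.sqrt ((α + 3) / α)) := by gcongr; exact hcos.2
        _ = _ := by rw [tvBound₂]; ring)
    (by fun_prop) hk hpk
  have h3 := hsm.comp_mul (b := Real.exp (-t / α) / σ) (by positivity) (∫ z, h z ∂μ)
  rw [mul_one] at h3
  convert h3 using 2 with x
  rw [steinMean, integral_sub (hμ.integrable_comp_affine h1 hc hL _ _) (integrable_const _),
    integral_const, probReal_univ, one_smul, hμ.integral_eq h1, smoothing]
  congr 1
  refine integral_congr_ae (ae_of_all _ fun z => ?_)
  simp only []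
  rw [← hσd]
  congr 2
  field_simp

/-! ### Estimates for the Stein solution and the conclusion. -/

theorem IsStandardStable.abs_steinSolution_sub_le (hμ : IsStandardStable α μ) (h1 : 1 < α)
    (h2 : α < 2) (hc : Continuous h) (hL : ∀ x y, |h x - h y| ≤ L * |x - y|) (x y : ℝ) :
    |steinSolution α μ h (x + y) - steinSolution α μ h x| ≤
      (∫ t in Ioi (0 : ℝ), L * Real.exp (-(1 / α) * t)) * |y| := by
  rw [hμ.steinSolution_eq h1, hμ.steinSolution_eq h1, neg_sub_neg, ← integral_sub
    (hμ.integrableOn_steinMean h1 hc hL _) (hμ.integrableOn_steinMean h1 hc hL _),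
    ← integral_mul_const, ← Real.norm_eq_abs]
  refine norm_integral_le_of_norm_le (((integrableOn_exp_mul_Ioi (a := -(1 / α))
    (neg_lt_zero.2 (by positivity)) 0).const_mul L).mul_const _)
    ((ae_restrict_iff' measurableSet_Ioi).2 (ae_of_all _ fun t ht => ?_))
  have h3 := (hμ.incrementBounds_steinMean h1 h2 hc hL ht).first x y
  rw [mul_assoc L, mul_div_cancel₀ _ (noiseScale_pos ht).ne'] at h3
  rw [norm_sub_rev, show -(1 / α) * t = -t / α by ring]
  exact h3

theorem IsStandardStable.symmDiff₂_steinSolution (hμ : IsStandardStable α μ) (h1 : 1 < α)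
    (hc : Continuous h) (hL : ∀ x y, |h x - h y| ≤ L * |x - y|) (x y : ℝ) :
    IntegrableOn (fun t => symmDiff₂ (fun x => steinMean α μ h x t) x y) (Ioi 0) ∧
    symmDiff₂ (steinSolution α μ h) x y =
      -∫ t in Ioi (0 : ℝ), symmDiff₂ (fun x => steinMean α μ h x t) x y := by
  have hi := hμ.integrableOn_steinMean h1 hc hL
  have ha : IntegrableOn (fun t => steinMean α μ h (x + y) t + steinMean α μ h (x - y) t) (Ioi 0) :=
    (hi _).add (hi _)
  refine ⟨ha.sub ((hi x).const_mul 2), ?_⟩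
  simp only [symmDiff₂, hμ.steinSolution_eq h1]
  rw [integral_sub ha ((hi x).const_mul 2), integral_add (hi _) (hi _), integral_const_mul]
  ring

/-- The factor `(scale) * (ratio) ^ β` of the increment bounds is a Beta kernel. -/
theorem noiseScale_mul_ratio_rpow {t : ℝ} (ht : 0 < t) (β : ℝ) :
    noiseScale α t * (Real.exp (-t / α) / noiseScale α t) ^ β =
      Real.exp (-(β / α * t)) * (1 - Real.exp (-t)) ^ ((1 - β) / α + 1 - 1) := by
  have h0 := one_sub_exp_neg_pos ht
  have hσ := noiseScale_pos (α := α) ht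
  rw [Real.div_rpow (Real.exp_pos _).le hσ.le, ← Real.exp_mul, mul_div_assoc', mul_comm,
    mul_div_assoc]
  congr 1
  · congr 1; ring
  · nth_rw 1 [← Real.rpow_one (noiseScale α t)]
    rw [← Real.rpow_sub hσ, noiseScale, ← Real.rpow_mul h0.le]
    congr 1; ring

theorem IsStandardStable.exists_abs_symmDiff₂_steinSolution_le (hμ : IsStandardStable α μ)
    (h1 : 1 < α) (h2 : α < 2) (hc : Continuous h) (hL : ∀ x y, |h x - h y| ≤ L * |x - y|) :
    ∃ C, ∀ x y, |symmDiff₂ (steinSolution α μ h) x y| ≤ C * y ^ 2 := by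
  have hα : 0 < α := by linarith
  -- The case `β = 2` of `noiseScale_mul_ratio_rpow`: the singularity at `t = 0` is `(1 -
  -- e^{-t})^{-1/α}`, integrable because `α > 1`.
  have hi := (integrableOn_exp_mul_one_sub_exp (s := (1 - 2) / α + 1) (β := 2 / α)
    (by have := (div_lt_one hα).2 h1; rw [show (1 - 2 : ℝ) / α = -(1 / α) by ring]; linarith)
    (by positivity)).const_mul (L * tvBound₁ α)
  refine ⟨∫ t in Ioi (0 : ℝ), L * tvBound₁ α *
    (Real.exp (-(2 / α * t)) * (1 - Real.exp (-t)) ^ ((1 - 2) / α + 1 - 1)), fun x y => ?_⟩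
  rw [(hμ.symmDiff₂_steinSolution h1 hc hL x y).2, abs_neg, ← integral_mul_const,
    ← Real.norm_eq_abs]
  refine norm_integral_le_of_norm_le (hi.mul_const _)
    ((ae_restrict_iff' measurableSet_Ioi).2 (ae_of_all _ fun t ht => ?_))
  refine ((hμ.incrementBounds_steinMean h1 h2 hc hL ht).abs_symmDiff₂_le x y).trans_eq ?_
  rw [← noiseScale_mul_ratio_rpow ht, Real.rpow_two]
  ring

theorem IsStandardStable.lintegral_symmDiff₂_steinSolution_le (hμ : IsStandardStable α μ)
    (h1 : 1 < α) (h2 : α < 2) (hc : Continuous h) (hL0 : 0 ≤ L)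
    (hL : ∀ x y, |h x - h y| ≤ L * |x - y|) {γ : ℝ} (hγ : γ ∈ Ioo (0 : ℝ) 1) (x x' : ℝ) :
    ∫⁻ y in Ioi (0 : ℝ), ‖(symmDiff₂ (steinSolution α μ h) x y -
        symmDiff₂ (steinSolution α μ h) x' y) / y ^ (1 + α)‖ₑ ≤
      ENNReal.ofReal (L * (holderConst α / α) * |x - x'| ^ γ *
        ProbabilityTheory.beta ((1 - γ) / α) ((γ + α) / α)) := by
  have hP := hμ.1
  have hα : 0 < α := by linarith
  let D : ℝ → ℝ → ℝ := fun y t => symmDiff₂ (fun x => steinMean α μ h x t) x y -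
    symmDiff₂ (fun x => steinMean α μ h x t) x' y
  have hm := measurable_steinMean (μ := μ) hα hc
  have hDm : Measurable fun q : ℝ × ℝ => ‖D q.1 q.2 / q.1 ^ (1 + α)‖ₑ := by
    have hm' : ∀ φ : ℝ → ℝ, Continuous φ →
        Measurable fun q : ℝ × ℝ => steinMean α μ h (φ q.1) q.2 := fun φ hφ =>
      hm.comp ((hφ.measurable.comp measurable_fst).prodMk measurable_snd)
    have hS : ∀ x, Measurable fun q : ℝ × ℝ =>
        symmDiff₂ (fun x => steinMean α μ h x q.2) x q.1 := fun x =>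
      ((hm' _ (continuous_const.add continuous_id)).add
        (hm' _ (continuous_const.sub continuous_id))).sub
        ((hm' _ (continuous_const (y := x))).const_mul 2)
    exact (((hS x).sub (hS x')).div (by fun_prop)).enorm
  have hpt : ∀ y, ‖(symmDiff₂ (steinSolution α μ h) x y -
      symmDiff₂ (steinSolution α μ h) x' y) / y ^ (1 + α)‖ₑ ≤
      ∫⁻ t in Ioi (0 : ℝ), ‖D y t / y ^ (1 + α)‖ₑ := by
    intro y
    have hx := hμ.symmDiff₂_steinSolution h1 hc hL x y
    have hx' := hμ.symmDiff₂_steinSolution h1 hc hL x' y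
    rw [hx.2, hx'.2, neg_sub_neg, ← integral_sub hx'.1 hx.1, ← integral_div]
    refine (enorm_integral_le_lintegral_enorm _).trans_eq (lintegral_congr fun t => ?_)
    rw [← enorm_neg, ← neg_div, neg_sub]
  have hα' : α ≠ 0 := hα.ne'
  have hC : 0 ≤ holderConst α / α := by
    have : 0 < 2 - α := by linarith
    have : 0 < α - 1 := by linarith
    have := Real.pi_pos
    rw [holderConst]; positivity
  calc _ ≤ ∫⁻ y in Ioi (0 : ℝ), ∫⁻ t in Ioi (0 : ℝ), ‖D y t / y ^ (1 + α)‖ₑ := lintegral_mono hpt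
    _ = ∫⁻ t in Ioi (0 : ℝ), ∫⁻ y in Ioi (0 : ℝ), ‖D y t / y ^ (1 + α)‖ₑ :=
        lintegral_lintegral_swap hDm.aemeasurable
    _ ≤ ∫⁻ t in Ioi (0 : ℝ), ENNReal.ofReal (L * (holderConst α / α) * |x - x'| ^ γ) *
          ENNReal.ofReal (Real.exp (-((γ + α) / α * t)) *
            (1 - Real.exp (-t)) ^ ((1 - γ) / α - 1)) := by
        refine setLIntegral_mono' measurableSet_Ioi fun t ht => ?_
        have hσ := noiseScale_pos (α := α) ht
        have hb : 0 < Real.exp (-t / α) / noiseScale α t := by positivity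
        refine ((hμ.incrementBounds_steinMean h1 h2 hc hL ht).lintegral_symmDiff₂_sub_le h1 h2
          (by positivity) hb hγ x x').trans_eq ?_
        rw [← ENNReal.ofReal_mul (by positivity)]
        congr 1
        -- The power `α` comes from the singular integral and `γ` from the interpolation; `γ < 1`
        -- keeps the first Beta parameter `(1 - γ)/α` positive.
        have e := noiseScale_mul_ratio_rpow (α := α) ht (γ + α)
        rw [show (1 - (γ + α)) / α + 1 - 1 = (1 - γ) / α - 1 by field_simp; ring] at e
        rw [← e, Real.rpow_add hb, Real.mul_rpow hb.le (abs_nonneg _)]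
        ring
    _ = _ := by
        rw [lintegral_const_mul' _ _ ENNReal.ofReal_ne_top, lintegral_exp_mul_one_sub_exp
          (div_pos (by linarith [hγ.2]) hα) (div_pos (by linarith [hγ.1]) hα),
          ← ENNReal.ofReal_mul (by positivity)]

end StableStein

theorem proposition4p4 (α : ℝ) (hα : α ∈ Set.Ioo (1 : ℝ) 2)
    (μ : MeasureTheory.Measure ℝ) (hμ : StableStein.IsStandardStable α μ)
    (h : ℝ → ℝ) (hh : ∃ K : NNReal, LipschitzWith K h) :
    StableStein.SteinSolutionWellDefined α μ h ∧
    (∀ x : ℝ, StableStein.FracLaplacianExists α (StableStein.steinSolution α μ h) x) ∧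
    ∀ γ ∈ Set.Ioo (0 : ℝ) 1, ∀ x y : ℝ, x ≠ y →
      |StableStein.fracLaplacian α (StableStein.steinSolution α μ h) x -
          StableStein.fracLaplacian α (StableStein.steinSolution α μ h) y| / |x - y| ^ γ ≤
        StableStein.dConst α / α *
          (16 / (Real.pi * (2 - α)) * Real.sqrt ((α + 3) / α) +
            16 / (Real.pi * (α - 1)) * Real.sqrt ((2 * α + 1) / α)) *
          ProbabilityTheory.beta ((1 - γ) / α) ((γ + α) / α) *
          StableStein.derivNorm h := by
  open StableStein in
  obtain ⟨K, hK⟩ := hh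
  obtain ⟨h1, h2⟩ := hα
  have hα0 : 0 < α := by linarith
  -- From here on `‖h'‖` replaces the arbitrary Lipschitz constant `K`.
  have hL := abs_sub_le_derivNorm hK
  have hc := hK.continuous
  have hf₀ := hμ.abs_steinSolution_sub_le h1 h2 hc hL
  have hfc : Continuous (steinSolution α μ h) := by
    refine (LipschitzWith.of_dist_le'
      (K := ∫ t in Ioi (0 : ℝ), derivNorm h * Real.exp (-(1 / α) * t)) fun x y => ?_).continuous
    have := hf₀ y (x - y)
    rwa [add_sub_cancel] at this
  obtain ⟨C, hf₁⟩ := hμ.exists_abs_symmDiff₂_steinSolution_le h1 h2 hc hL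
  have hT := fun x => tendsto_truncatedIntegral h1 h2 hfc (hf₀ x) (hf₁ x)
  refine ⟨⟨hμ.integrable_of_lipschitz h1 hc hL,
    fun x t ht => hμ.integrable_steinIntegrand h1 hc hL x ht,
    fun x => (hμ.integrableOn_steinMean h1 hc hL x).congr_fun
      (fun t ht => (hμ.integral_steinIntegrand h1 x ht).symm) measurableSet_Ioi⟩,
    fun x => ⟨fun r hr => integrableOn_truncated h1 hfc (hf₀ x) hr, _, (hT x).2⟩,
    fun γ hγ x y hxy => ?_⟩
  have hxy' : 0 < |x - y| ^ γ := Real.rpow_pos_of_pos (abs_pos.2 (sub_ne_zero.2 hxy)) _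
  have hB := ProbabilityTheory.beta_pos (α := (1 - γ) / α) (β := (γ + α) / α)
    (div_pos (by linarith [hγ.2]) hα0) (div_pos (by linarith [hγ.1]) hα0)
  have hH : 0 ≤ holderConst α := by
    have : 0 < 2 - α := by linarith
    have : 0 < α - 1 := by linarith
    have := Real.pi_pos
    rw [holderConst]; positivity
  have hLn := derivNorm_nonneg h
  have hnn : 0 ≤ derivNorm h * (holderConst α / α) * |x - y| ^ γ *
      ProbabilityTheory.beta ((1 - γ) / α) ((γ + α) / α) :=
    mul_nonneg (mul_nonneg (mul_nonneg hLn (div_nonneg hH hα0.le)) hxy'.le) hB.le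
  have key := hμ.lintegral_symmDiff₂_steinSolution_le h1 h2 hc hLn hL hγ x y
  simp only [sub_div (symmDiff₂ _ _ _)] at key
  have key2 := (enorm_integral_le_lintegral_enorm (μ := volume.restrict (Ioi (0 : ℝ))) _).trans key
  rw [integral_sub (hT x).1 (hT y).1, Real.enorm_eq_ofReal_abs,
    ENNReal.ofReal_le_ofReal_iff hnn] at key2
  rw [fracLaplacian, fracLaplacian, (hT x).2.limUnder_eq, (hT y).2.limUnder_eq, ← mul_sub, abs_mul,
    abs_of_nonneg (dConst_nonneg α), div_le_iff₀ hxy']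
  refine (mul_le_mul_of_nonneg_left key2 (dConst_nonneg α)).trans_eq ?_
  rw [holderConst]
  ring
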